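/- Let $(\mathfrak g,\omega)$ be an eight-dimensional real symplectic Lie algebra, that is, $\omega$ is a non-degenerate alternating bilinear form on $\mathfrak g$ with $\omega([x,y],z)+\omega([y,z],x)+\omega([z,x],y)=0$ for all $x,y,z$. For an ideal $\mathfrak j$ of $\mathfrak g$ put $\mathfrak j^{\perp}=\{x\in\mathfrak g:\omega(x,y)=0\text{ for all }y\in\mathfrak j\}$. The ideal $\mathfrak j$ is isotropic if $\mathfrak j\subseteq\mathfrak j^{\perp}$, and a normal isotropic ideal if moreover $\mathfrak j^{\perp}$ is an ideal of $\mathfrak g$. The symplectic reduction of $(\mathfrak g,\omega)$ with respect to an isotropic ideal $\mathfrak j$ is the quotient $\mathfrak j^{\perp}/\mathfrak j$ with the induced symplectic form, and $(\mathfrak g,\omega)$ is non completely reducible if no finite sequence of successive symplectic reductions leads from it to the trivial symplectic Lie algebra $\{0\}$. Suppose that $(\mathfrak g,\omega)$ is non completely reducible and has a nonzero normal isotropic ideal that is not contained in the center of $\mathfrak g$. Then there is a Lie algebra isomorphism carrying $\omega$ to the form of one of the following symplectic Lie algebras, given in a basis $e_1,\dots,e_8$ with dual basis $e^1,\dots,e^8$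 and $e^{ij}=e^i\wedge e^j$. All four have the brackets $$[e_1,e_5]=e_2,\quad [e_2,e_5]=-e_1,\quad [e_3,e_6]=e_4,\quad [e_4,e_6]=-e_3,\quad [e_8,e_7]=e_7,$$ the brackets that are not listed here or below (and do not follow from these by skew-symmetry) vanish, and the parameters are $\eta>0$, $\alpha,\beta\in\mathbb R$, $t\in\mathbb R\setminus\{0\}$: 1. $\mathfrak g_{8,1}$: no further brackets, with $\omega=e^{12}+e^{34}+\eta e^{56}+\alpha e^{58}+\beta e^{68}+e^{78}$; 2. $\mathfrak g_{8,2}$: $[e_1,e_2]=[e_3,e_4]=t\,e_7$ and $[e_8,e_i]=\tfrac12 e_i$ for $i=1,2,3,4$, with $\omega=e^{12}+e^{34}+\eta e^{56}+\alpha e^{58}+\beta e^{68}-\tfrac1t e^{78}$; 3. $\mathfrak g_{8,3}$: $[e_1,e_2]=t\,e_7$ and $[e_8,e_i]=\tfrac12 e_i$ for $i=1,2$, with $\omega$ as in 2; 4. $\mathfrak g_{8,4}$: $[e_3,e_4]=t\,e_7$ and $[e_8,e_i]=\tfrac12 e_i$ for $i=3,4$, with $\omega$ as in 2. -/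

import Mathlib

/-! ### Symplectic Lie algebras -/

/-- A symplectic form on a real Lie algebra: a closed non-degenerate alternating `2`-form. -/
structure SymplecticForm (𝔤 : Type*) [LieRing 𝔤] [LieAlgebra ℝ 𝔤] where
  form : LinearMap.BilinForm ℝ 𝔤
  alt : form.IsAlt
  closed : ∀ x y z : 𝔤, form ⁅x, y⁆ z + form ⁅y, z⁆ x + form ⁅z, x⁆ y = 0
  nondegenerate : form.Nondegenerate

/-- Two symplectic Lie algebras are symplectomorphically isomorphic if there is a Lie algebra
isomorphism which pulls the second form back to the first. -/
def Symplectomorphic {𝔤₁ 𝔤₂ : Type*} [LieRing 𝔤₁] [LieAlgebra ℝ 𝔤₁] [LieRing 𝔤₂]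
    [LieAlgebra ℝ 𝔤₂] (ω₁ : SymplecticForm 𝔤₁) (ω₂ : SymplecticForm 𝔤₂) : Prop :=
  ∃ Ψ : 𝔤₁ ≃ₗ⁅ℝ⁆ 𝔤₂, ∀ x y : 𝔤₁, ω₂.form (Ψ x) (Ψ y) = ω₁.form x y

namespace SymplecticForm

section

variable {𝔤 : Type*} [LieRing 𝔤] [LieAlgebra ℝ 𝔤]

/-- The `ω`-orthogonal `{x | ω(x, y) = 0 for all y ∈ 𝔧}` of an ideal `𝔧`, a subalgebra. -/
def orth (ω : SymplecticForm 𝔤) (j : LieIdeal ℝ 𝔤) : LieSubalgebra ℝ 𝔤 where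
  carrier := {x | ∀ y ∈ j, ω.form x y = 0}
  add_mem' := by
    intro a b ha hb y hy
    simp [ha y hy, hb y hy]
  zero_mem' := by
    intro y _
    simp
  smul_mem' := by
    intro c x hx y hy
    simp [hx y hy]
  lie_mem' := by
    intro a b ha hb y hy
    have h := ω.closed a b y
    have h1 : ω.form ⁅b, y⁆ a = 0 :=
      ω.alt.isRefl _ _ (ha _ (lie_mem_right ℝ 𝔤 j b y hy))
    have h2 : ω.form ⁅y, a⁆ b = 0 :=
      ω.alt.isRefl _ _ (hb _ (lie_mem_left ℝ 𝔤 j y a hy))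
    rw [h1, h2] at h
    simpa using h

theorem mem_orth (ω : SymplecticForm 𝔤) (j : LieIdeal ℝ 𝔤) (x : 𝔤) :
    x ∈ ω.orth j ↔ ∀ y ∈ j, ω.form x y = 0 := Iff.rfl

/-- An ideal `𝔧` is isotropic if `𝔧 ⊆ 𝔧^⊥`. -/
def IsIsotropic (ω : SymplecticForm 𝔤) (j : LieIdeal ℝ 𝔤) : Prop :=
  ∀ x ∈ j, x ∈ ω.orth j

/-- An isotropic ideal `𝔧` is normal if `𝔧^⊥` is an ideal of `𝔤`. -/
def IsNormalIsotropic (ω : SymplecticForm 𝔤) (j : LieIdeal ℝ 𝔤) : Prop :=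
  ω.IsIsotropic j ∧ ∀ x : 𝔤, ∀ y ∈ ω.orth j, ⁅x, y⁆ ∈ ω.orth j

/-- The quotient Lie algebra `𝔧^⊥ / 𝔧`, where `𝔧` is seen as an ideal of `𝔧^⊥`. -/
abbrev Reduction (ω : SymplecticForm 𝔤) (j : LieIdeal ℝ 𝔤) : Type _ :=
  ↥(ω.orth j) ⧸ (j.comap (ω.orth j).incl)

theorem mem_comap_incl (ω : SymplecticForm 𝔤) (j : LieIdeal ℝ 𝔤) (x : ω.orth j) :
    x ∈ (j.comap (ω.orth j).incl).toSubmodule ↔ (x : 𝔤) ∈ j := by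
  rw [LieSubmodule.mem_toSubmodule, LieIdeal.mem_comap]
  rfl

/-- The bilinear form on `𝔧^⊥ / 𝔧` induced by `ω`. -/
def reductionForm (ω : SymplecticForm 𝔤) (j : LieIdeal ℝ 𝔤) :
    LinearMap.BilinForm ℝ (ω.Reduction j) :=
  LinearMap.liftQ₂ (j.comap (ω.orth j).incl).toSubmodule (j.comap (ω.orth j).incl).toSubmodule
    (ω.form.restrict (ω.orth j).toSubmodule)
    (by
      intro x hx
      rw [mem_comap_incl] at hx
      rw [LinearMap.mem_ker]
      ext y
      exact ω.alt.isRefl _ _ (y.2 _ hx))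
    (by
      intro x hx
      rw [mem_comap_incl] at hx
      rw [LinearMap.mem_ker]
      ext y
      exact y.2 _ hx)

theorem reductionForm_mk (ω : SymplecticForm 𝔤) (j : LieIdeal ℝ 𝔤) (x y : ω.orth j) :
    ω.reductionForm j (LieSubmodule.Quotient.mk x) (LieSubmodule.Quotient.mk y) =
      ω.form (x : 𝔤) (y : 𝔤) := rfl

/-- The symplectic reduction `(𝔧^⊥ / 𝔧, ω̄)` of `(𝔤, ω)` with respect to an isotropic ideal. -/
def reduce [FiniteDimensional ℝ 𝔤] (ω : SymplecticForm 𝔤) (j : LieIdeal ℝ 𝔤)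
    (_hj : ω.IsIsotropic j) : SymplecticForm (ω.Reduction j) where
  form := ω.reductionForm j
  alt := by
    intro x
    induction x using Submodule.Quotient.induction_on with
    | H x => exact ω.alt x
  closed := by
    intro x y z
    induction x using Submodule.Quotient.induction_on with
    | H x =>
      induction y using Submodule.Quotient.induction_on with
      | H y =>
        induction z using Submodule.Quotient.induction_on with
        | H z => exact ω.closed x y z
  nondegenerate := by
    have halt : (ω.reductionForm j).IsAlt := by
      intro x
      induction x using Submodule.Quotient.induction_on with
      | H x => exact ω.alt x
    have key : ∀ x : ω.orth j, (∀ y : ω.orth j, ω.form (x : 𝔤) y = 0) → (x : 𝔤) ∈ j := by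
      intro x hx
      have h := LinearMap.BilinForm.orthogonal_orthogonal ω.nondegenerate ω.alt.isRefl
        j.toSubmodule
      rw [← LieSubmodule.mem_toSubmodule, ← h]
      rw [LinearMap.BilinForm.mem_orthogonal_iff]
      intro n hn
      rw [LinearMap.BilinForm.mem_orthogonal_iff] at hn
      have hn' : n ∈ ω.orth j := fun y hy => ω.alt.isRefl _ _ (hn y hy)
      exact ω.alt.isRefl _ _ (hx ⟨n, hn'⟩)
    have hleft : (ω.reductionForm j).SeparatingLeft := by
      intro x hx
      induction x using Submodule.Quotient.induction_on with
      | H x =>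
        refine (Submodule.Quotient.mk_eq_zero _).2 ?_
        rw [mem_comap_incl]
        exact key x fun y => hx (LieSubmodule.Quotient.mk y)
    refine ⟨hleft, fun y hy => hleft y fun x => halt.isRefl _ _ (hy x)⟩

end

/-- `(𝔤, ω)` is completely reducible if a finite sequence of symplectic reductions leads from it
to the trivial symplectic Lie algebra `{0}`. -/
inductive IsCompletelyReducible.{u} : ∀ {𝔤 : Type u} [LieRing 𝔤] [LieAlgebra ℝ 𝔤]
    [FiniteDimensional ℝ 𝔤], SymplecticForm 𝔤 → Prop
  | trivial {𝔤 : Type u} [LieRing 𝔤] [LieAlgebra ℝ 𝔤] [FiniteDimensional ℝ 𝔤] [Subsingleton 𝔤]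
      (ω : SymplecticForm 𝔤) : IsCompletelyReducible ω
  | step {𝔤 : Type u} [LieRing 𝔤] [LieAlgebra ℝ 𝔤] [FiniteDimensional ℝ 𝔤]
      (ω : SymplecticForm 𝔤) (j : LieIdeal ℝ 𝔤) (hj : ω.IsIsotropic j)
      (h : IsCompletelyReducible (ω.reduce j hj)) : IsCompletelyReducible ω

end SymplecticForm

/-! ### The normal oxidations of `𝔤_(1,0,0,1)`

The basis `e₁, …, e₈` is indexed by `0, …, 7`. -/

/-- `e^{ij}(x, y)` for the standard coordinates on `ℝ⁸` (indices start at `0`). -/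
def wedge (i j : Fin 8) (x y : Fin 8 → ℝ) : ℝ := x i * y j - x j * y i

/-- Structure constants of an eight-dimensional normal oxidation of `𝔤_(1,0,0,1)`; the two
equations are what the Jacobi identity amounts to. -/
structure NormalData where
  a : ℝ
  b : ℝ
  p : ℝ
  q : ℝ
  jacobi_p : p * (2 * a - 1) = 0
  jacobi_q : q * (2 * b - 1) = 0

/-- The Lie algebra with basis `e₁, …, e₈` and non-vanishing brackets
`[e₁,e₅] = e₂`, `[e₂,e₅] = -e₁`, `[e₃,e₆] = e₄`, `[e₄,e₆] = -e₃`,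
`[e₁,e₂] = p e₇`, `[e₃,e₄] = q e₇`, `[e₈,e₁] = a e₁`, `[e₈,e₂] = a e₂`,
`[e₈,e₃] = b e₃`, `[e₈,e₄] = b e₄`, `[e₈,e₇] = e₇`. -/
def NormalData.Algebra (_d : NormalData) : Type := Fin 8 → ℝ

namespace NormalData

noncomputable section

variable (d : NormalData)

instance : AddCommGroup d.Algebra := inferInstanceAs (AddCommGroup (Fin 8 → ℝ))

instance : Module ℝ d.Algebra := inferInstanceAs (Module ℝ (Fin 8 → ℝ))

instance : FiniteDimensional ℝ d.Algebra := inferInstanceAs (FiniteDimensional ℝ (Fin 8 → ℝ))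

/-- The coordinates of a vector in the basis `e₁, …, e₈`. -/
def coord : d.Algebra ≃ₗ[ℝ] (Fin 8 → ℝ) := LinearEquiv.refl ℝ (Fin 8 → ℝ)

/-- The coordinates of `[x, y]` in terms of those of `x` and `y`. -/
def bracketCoord (x y : Fin 8 → ℝ) : Fin 8 → ℝ :=
  ![- wedge 1 4 x y + d.a * wedge 7 0 x y,
    wedge 0 4 x y + d.a * wedge 7 1 x y,
    - wedge 3 5 x y + d.b * wedge 7 2 x y,
    wedge 2 5 x y + d.b * wedge 7 3 x y,
    0,
    0,
    d.p * wedge 0 1 x y + d.q * wedge 2 3 x y + wedge 7 6 x y,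
    0]

instance : Bracket d.Algebra d.Algebra :=
  ⟨fun x y => d.coord.symm (d.bracketCoord (d.coord x) (d.coord y))⟩

theorem coord_lie (x y : d.Algebra) :
    d.coord ⁅x, y⁆ = d.bracketCoord (d.coord x) (d.coord y) :=
  d.coord.apply_symm_apply _

instance : LieRing d.Algebra where
  add_lie x y z := by
    apply d.coord.injective
    simp only [map_add, coord_lie]
    ext i
    fin_cases i <;> simp [bracketCoord, wedge] <;> ring
  lie_add x y z := by
    apply d.coord.injective
    simp only [map_add, coord_lie]
    ext i
    fin_cases i <;> simp [bracketCoord, wedge] <;> ring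
  lie_self x := by
    apply d.coord.injective
    simp only [map_zero, coord_lie]
    ext i
    fin_cases i <;> simp [bracketCoord, wedge] <;> ring
  leibniz_lie x y z := by
    apply d.coord.injective
    have hp := d.jacobi_p
    have hq := d.jacobi_q
    simp only [map_add, coord_lie]
    ext i
    fin_cases i
    all_goals simp [bracketCoord, wedge]
    pick_goal 5
    · linear_combination
        (d.coord x 0 * (d.coord y 1 * d.coord z 7 - d.coord y 7 * d.coord z 1)
          - d.coord x 1 * (d.coord y 0 * d.coord z 7 - d.coord y 7 * d.coord z 0)
          + d.coord x 7 * (d.coord y 0 * d.coord z 1 - d.coord y 1 * d.coord z 0)) * (-hp)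
        + (d.coord x 2 * (d.coord y 3 * d.coord z 7 - d.coord y 7 * d.coord z 3)
          - d.coord x 3 * (d.coord y 2 * d.coord z 7 - d.coord y 7 * d.coord z 2)
          + d.coord x 7 * (d.coord y 2 * d.coord z 3 - d.coord y 3 * d.coord z 2)) * (-hq)
    all_goals ring

instance : LieAlgebra ℝ d.Algebra where
  lie_smul t x y := by
    apply d.coord.injective
    simp only [map_smul, coord_lie]
    ext i
    fin_cases i <;> simp [bracketCoord, wedge] <;> ring

/-- The symplectic form `e^{12} + e^{34} + η e^{56} + α e^{58} + β e^{68} + c e^{78}`; the last two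
hypotheses are what closedness amounts to. -/
def symplecticForm (η α β c : ℝ) (hη : η ≠ 0) (hc : c ≠ 0)
    (hp : c * d.p + 2 * d.a = 0) (hq : c * d.q + 2 * d.b = 0) : SymplecticForm d.Algebra where
  form := LinearMap.mk₂ ℝ
    (fun x y : d.Algebra =>
      wedge 0 1 (d.coord x) (d.coord y) + wedge 2 3 (d.coord x) (d.coord y)
        + η * wedge 4 5 (d.coord x) (d.coord y) + α * wedge 4 7 (d.coord x) (d.coord y)
        + β * wedge 5 7 (d.coord x) (d.coord y) + c * wedge 6 7 (d.coord x) (d.coord y))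
    (by intros; simp only [wedge, map_add, Pi.add_apply]; ring)
    (by intros; simp only [wedge, map_smul, Pi.smul_apply, smul_eq_mul]; ring)
    (by intros; simp only [wedge, map_add, Pi.add_apply]; ring)
    (by intros; simp only [wedge, map_smul, Pi.smul_apply, smul_eq_mul]; ring)
  alt := by
    intro x
    simp only [LinearMap.mk₂_apply, wedge]
    ring
  closed := by
    intro x y z
    simp only [LinearMap.mk₂_apply, coord_lie]
    simp [bracketCoord, wedge]
    linear_combination
      (d.coord x 0 * (d.coord y 1 * d.coord z 7 - d.coord y 7 * d.coord z 1)
        - d.coord x 1 * (d.coord y 0 * d.coord z 7 - d.coord y 7 * d.coord z 0)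
        + d.coord x 7 * (d.coord y 0 * d.coord z 1 - d.coord y 1 * d.coord z 0)) * hp
      + (d.coord x 2 * (d.coord y 3 * d.coord z 7 - d.coord y 7 * d.coord z 3)
        - d.coord x 3 * (d.coord y 2 * d.coord z 7 - d.coord y 7 * d.coord z 2)
        + d.coord x 7 * (d.coord y 2 * d.coord z 3 - d.coord y 3 * d.coord z 2)) * hq
  nondegenerate := by
    have key : ∀ x : Fin 8 → ℝ, (∀ y : Fin 8 → ℝ,
        wedge 0 1 x y + wedge 2 3 x y + η * wedge 4 5 x y + α * wedge 4 7 x y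
          + β * wedge 5 7 x y + c * wedge 6 7 x y = 0) → x = 0 := by
      intro x hx
      have h0 := hx (Pi.single 0 1)
      have h1 := hx (Pi.single 1 1)
      have h2 := hx (Pi.single 2 1)
      have h3 := hx (Pi.single 3 1)
      have h4 := hx (Pi.single 4 1)
      have h5 := hx (Pi.single 5 1)
      have h6 := hx (Pi.single 6 1)
      have h7 := hx (Pi.single 7 1)
      simp [wedge, hc] at h0 h1 h2 h3 h6
      simp [wedge, h6, hη] at h4 h5
      simp [wedge, h4, h5, hc] at h7
      ext i
      fin_cases i <;> simp [h0, h1, h2, h3, h4, h5, h6, h7]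
    have hleft : ∀ x : d.Algebra, (∀ y : d.Algebra,
        wedge 0 1 (d.coord x) (d.coord y) + wedge 2 3 (d.coord x) (d.coord y)
          + η * wedge 4 5 (d.coord x) (d.coord y) + α * wedge 4 7 (d.coord x) (d.coord y)
          + β * wedge 5 7 (d.coord x) (d.coord y) + c * wedge 6 7 (d.coord x) (d.coord y) = 0) →
        x = 0 := fun x hx => key x hx
    refine ⟨fun x hx => hleft x fun y => ?_, fun x hx => hleft x fun y => ?_⟩
    · simpa only [LinearMap.mk₂_apply] using hx y
    · have h := hx y
      simp only [LinearMap.mk₂_apply, wedge] at h ⊢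
      linear_combination -h

/-- `[e₈,e₇] = e₇`, besides the brackets of `𝔤_(1,0,0,1)`. -/
def g81 : NormalData := ⟨0, 0, 0, 0, by norm_num, by norm_num⟩

/-- `[e₁,e₂] = [e₃,e₄] = t e₇`, `[e₈,eᵢ] = ½ eᵢ` for `i ≤ 4`, `[e₈,e₇] = e₇`, besides the brackets
of `𝔤_(1,0,0,1)`. -/
def g82 (t : ℝ) : NormalData := ⟨1 / 2, 1 / 2, t, t, by ring, by ring⟩

/-- `[e₁,e₂] = t e₇`, `[e₈,e₁] = ½ e₁`, `[e₈,e₂] = ½ e₂`, `[e₈,e₇] = e₇`, besides the brackets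
of `𝔤_(1,0,0,1)`. -/
def g83 (t : ℝ) : NormalData := ⟨1 / 2, 0, t, 0, by ring, by ring⟩

/-- `[e₃,e₄] = t e₇`, `[e₈,e₃] = ½ e₃`, `[e₈,e₄] = ½ e₄`, `[e₈,e₇] = e₇`, besides the brackets
of `𝔤_(1,0,0,1)`. -/
def g84 (t : ℝ) : NormalData := ⟨0, 1 / 2, 0, t, by ring, by ring⟩

/-- `ω = e^{12} + e^{34} + η e^{56} + α e^{58} + β e^{68} + e^{78}`. -/
def ω81 (η α β : ℝ) (hη : 0 < η) : SymplecticForm g81.Algebra :=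
  g81.symplecticForm η α β 1 hη.ne' one_ne_zero (by simp [g81]) (by simp [g81])

/-- `ω = e^{12} + e^{34} + η e^{56} + α e^{58} + β e^{68} - (1/t) e^{78}`. -/
def ω82 (t η α β : ℝ) (ht : t ≠ 0) (hη : 0 < η) : SymplecticForm (g82 t).Algebra :=
  (g82 t).symplecticForm η α β (-(1 / t)) hη.ne' (by simp [ht]) (by simp [g82, ht])
    (by simp [g82, ht])

/-- `ω = e^{12} + e^{34} + η e^{56} + α e^{58} + β e^{68} - (1/t) e^{78}`. -/
def ω83 (t η α β : ℝ) (ht : t ≠ 0) (hη : 0 < η) : SymplecticForm (g83 t).Algebra :=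
  (g83 t).symplecticForm η α β (-(1 / t)) hη.ne' (by simp [ht]) (by simp [g83, ht])
    (by simp [g83])

/-- `ω = e^{12} + e^{34} + η e^{56} + α e^{58} + β e^{68} - (1/t) e^{78}`. -/
def ω84 (t η α β : ℝ) (ht : t ≠ 0) (hη : 0 < η) : SymplecticForm (g84 t).Algebra :=
  (g84 t).symplecticForm η α β (-(1 / t)) hη.ne' (by simp [ht]) (by simp [g84])
    (by simp [g84, ht])

end

end NormalData

/-! Reducing by the given ideal `j` leaves a symplectic algebra of dimension at most six that is
again not completely reducible. The proof determines this reduction and then reconstructs `𝔤` from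
it.

An irreducible symplectic algebra, one without nonzero isotropic ideals, splits as `a ⊕ a^⊥` for
every abelian ideal `a`, and `a^⊥` acts on `a` by `ω`-skew maps. Killing forms and Cartan's
criterion show that every nonzero ideal contains a nonzero abelian one, so for maximal `a` the
action is faithful (`IsIrreducible.exists_faithful`). In dimension at most six, parity and `dim
𝔰𝔭(2) = 3` make `a^⊥` two-dimensional; a trace argument makes it abelian
(`IsIrreducible.lie_orth_eq_zero`); Schur's lemma turns minimal ideals in `a` into planes of
rotations (`IsIrreducible.exists_plane`). Two such planes and the dual basis of `a^⊥` give the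
unique model (`IsIrreducible.exists_isFrame`), which has dimension six. Hence the reduction of `𝔤`
is this model and `j` is a line.

Normality and non-centrality provide `z ∈ j` and `y` with `[y,z] = z` and `ω(z,y) = 1`, while `j^⊥`
centralizes `j`. The derivation of the reduction induced by `y` is diagonal, with weights `a, a, b,
b, 0, 0`, once `y` is changed by an element of `j^⊥` (`IsFrame.exists_derivation`). Closedness of
`ω` then fixes the `z`-components of all brackets, and the Jacobi identity leaves `a, b ∈ {0, 1/2}`:
the four families. -/

open LieAlgebra

/-! ### Abelian ideals from the Killing form -/

namespace SymplecticForm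

variable {𝔤 : Type*} [LieRing 𝔤] [LieAlgebra ℝ 𝔤]

theorem form_swap (ω : SymplecticForm 𝔤) (x y : 𝔤) : ω.form x y = - ω.form y x := by
  exact (LinearMap.IsAlt.neg ω.alt y x).symm

theorem eq_zero_of_form_eq_zero (ω : SymplecticForm 𝔤) {x : 𝔤} (h : ∀ y, ω.form x y = 0) :
    x = 0 := ω.nondegenerate.1 x h

/-- An ideal on which the Killing form is non-degenerate vanishes in a symplectic Lie algebra. -/
theorem eq_bot_of_disjoint_killingCompl [FiniteDimensional ℝ 𝔤] (ω : SymplecticForm 𝔤)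
    (k : LieIdeal ℝ 𝔤) (hk : k ⊓ k.killingCompl = ⊥) : k = ⊥ := by
  have hsymm : (killingForm ℝ 𝔤).IsRefl := (LieModule.traceForm_isSymm ℝ 𝔤 𝔤).isRefl
  have hnd : (killingForm ℝ k).Nondegenerate := by
    refine (LieModule.traceForm_isSymm ℝ k k).isRefl.nondegenerate_iff_separatingLeft.mpr ?_
    intro x hx
    have : (x : 𝔤) ∈ k ⊓ k.killingCompl := by
      refine ⟨x.2, ?_⟩
      refine (LieIdeal.mem_killingCompl ℝ 𝔤 k).2 ?_
      intro y hy
      have := hx ⟨y, hy⟩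
      change killingForm ℝ k x ⟨y, hy⟩ = 0 at this
      rw [LieIdeal.killingForm_eq] at this
      rw [LieModule.traceForm_comm]
      exact this
    rw [hk] at this
    exact Subtype.ext (by simpa using this)
  have hkil : IsKilling ℝ k := by
    constructor
    rw [eq_bot_iff]
    intro x hx
    rw [LieIdeal.mem_killingCompl] at hx
    exact hnd.2 x fun y => hx y trivial
  have hcompl : IsCompl k.toSubmodule k.killingCompl.toSubmodule := by
    rw [LieIdeal.toSubmodule_killingCompl, LinearMap.BilinForm.isCompl_orthogonal_iff_disjoint hsymm,
      ← LieIdeal.toSubmodule_killingCompl, disjoint_iff, ← LieSubmodule.inf_toSubmodule, hk]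
    rfl
  have hcomm : ∀ x ∈ k, ∀ w ∈ k.killingCompl, ⁅x, w⁆ = 0 := by
    intro x hx w hw
    have : ⁅x, w⁆ ∈ k ⊓ k.killingCompl :=
      ⟨lie_mem_left ℝ 𝔤 k x w hx, lie_mem_right ℝ 𝔤 _ x w hw⟩
    rw [hk] at this
    simpa using this
  have hdec : ∀ v : 𝔤, ∃ x ∈ k, ∃ w ∈ k.killingCompl, x + w = v := by
    intro v
    have : v ∈ k.toSubmodule ⊔ k.killingCompl.toSubmodule := by
      rw [hcompl.sup_eq_top]; trivial
    simpa [Submodule.mem_sup] using this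
  have hinv : ∀ x y z : k, killingForm ℝ k ⁅x, y⁆ z = killingForm ℝ k x ⁅y, z⁆ :=
    LieModule.traceForm_apply_lie_apply ℝ k k
  -- The Killing dual `x` of `ω(·, w)` is central: since `w` commutes with `k`, closedness kills
  -- `ω(·, w)` on brackets of `k`. Then `ad x = 0`, so `x` is Killing-orthogonal to `k`.
  have hcross : ∀ w ∈ k.killingCompl, ∀ y ∈ k, ω.form y w = 0 := by
    intro w hw y hy
    let f : k →ₗ[ℝ] ℝ := (ω.form.flip w) ∘ₗ k.toSubmodule.subtype
    set x := (killingForm ℝ k).toDual hnd |>.symm f with hx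
    have hxf : ∀ y : k, killingForm ℝ k x y = ω.form y w := fun y =>
      LinearMap.BilinForm.apply_toDual_symm_apply (hB := hnd) f y
    have hc : ∀ y : k, ⁅x, y⁆ = 0 := by
      intro y
      apply hnd.1
      intro y'
      rw [hinv, hxf]
      have := ω.closed y y' w
      rw [hcomm y' y'.2 w hw, ← lie_skew w, hcomm y y.2 w hw] at this
      simpa using this
    have h0 : x = 0 := by
      apply hnd.1
      intro y
      rw [killingForm_apply_apply]
      have : ad ℝ k x = 0 := by ext z; simp [hc z]
      simp [this]
    rw [← hxf ⟨y, hy⟩, h0]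
    simp
  -- `E` expresses `ω` on `k` through the Killing form. Closedness of `ω` says that `E` is a
  -- derivation, hence inner, `E = ad u`; then `u` lies in the radical of `ω` because `[u,u] = 0`.
  let E : k →ₗ[ℝ] k := ((killingForm ℝ k).toDual hnd).symm.toLinearMap ∘ₗ
    ω.form.restrict k.toSubmodule
  have hE : ∀ x y : k, killingForm ℝ k (E x) y = ω.form x y := fun x y =>
    LinearMap.BilinForm.apply_toDual_symm_apply (hB := hnd) _ y
  have hksymm : ∀ x y : k, killingForm ℝ k x y = killingForm ℝ k y x :=
    LieModule.traceForm_comm ℝ k k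
  let D : LieDerivation ℝ k k :=
    { toLinearMap := E
      leibniz' := by
        intro x y
        rw [← sub_eq_zero]
        apply hnd.1
        intro z
        have h1 : killingForm ℝ k ⁅x, E y⁆ z = - ω.form y ⁅(x : 𝔤), (z : 𝔤)⁆ := by
          rw [← lie_skew, map_neg, LinearMap.neg_apply, hinv, hE]
          rfl
        have h2 : killingForm ℝ k ⁅y, E x⁆ z = - ω.form x ⁅(y : 𝔤), (z : 𝔤)⁆ := by
          rw [← lie_skew, map_neg, LinearMap.neg_apply, hinv, hE]
          rfl
        have h3 := ω.closed x y z
        rw [← lie_skew (z : 𝔤), map_neg, LinearMap.neg_apply, ω.form_swap ⁅(y : 𝔤), (z : 𝔤)⁆,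
          ω.form_swap ⁅(x : 𝔤), (z : 𝔤)⁆] at h3
        rw [map_sub, map_sub, LinearMap.sub_apply, LinearMap.sub_apply, h1, h2, hE]
        refine Eq.trans ?_ h3
        change ω.form ⁅(x : 𝔤), (y : 𝔤)⁆ z - _ = _
        ring }
  obtain ⟨u, hu⟩ := LieDerivation.IsKilling.exists_eq_ad D
  have hEu : ∀ x, E x = ⁅u, x⁆ := by
    intro x
    have := congrArg (fun F : LieDerivation ℝ k k => F x) hu
    rw [LieDerivation.ad_apply_apply] at this
    exact this.symm
  have hu0 : (u : 𝔤) = 0 := by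
    apply ω.eq_zero_of_form_eq_zero
    intro v
    obtain ⟨x, hx, w, hw, rfl⟩ := hdec v
    rw [map_add, hcross w hw u u.2, add_zero]
    rw [← hE u ⟨x, hx⟩, hEu, lie_self]
    simp
  have hu0' : u = 0 := Subtype.ext hu0
  rw [eq_bot_iff]
  intro x hx
  rw [LieSubmodule.mem_bot]
  apply ω.eq_zero_of_form_eq_zero
  intro v
  obtain ⟨y, hy, w, hw, rfl⟩ := hdec v
  rw [map_add, hcross w hw x hx, add_zero, ← hE ⟨x, hx⟩ ⟨y, hy⟩, hEu, hu0', zero_lie]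
  simp

/-- Every nonzero ideal of a symplectic Lie algebra contains a nonzero abelian ideal. -/
theorem exists_abelian_le [FiniteDimensional ℝ 𝔤] (ω : SymplecticForm 𝔤)
    (k : LieIdeal ℝ 𝔤) (hk : k ≠ ⊥) :
    ∃ b : LieIdeal ℝ 𝔤, b ≤ k ∧ b ≠ ⊥ ∧ ∀ x ∈ b, ∀ y ∈ b, ⁅x, y⁆ = 0 := by
  set I := k ⊓ k.killingCompl with hI
  have hI0 : I ≠ ⊥ := fun h => hk (ω.eq_bot_of_disjoint_killingCompl k h)
  -- Cartan's criterion: the Killing form of `𝔤` vanishes on `I × I`, as one factor lies in `k` and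
  -- the other in its Killing complement.
  have hsol : IsSolvable I := by
    apply LieIdeal.isSolvable_of_killingForm_apply_lie_eq_zero
    intro x hx y hy
    have hy' : y ∈ I := LieSubmodule.lie_le_left I I hy
    exact (LieIdeal.mem_killingCompl ℝ 𝔤 k).1 hy'.2 x hx.1
  refine ⟨derivedAbelianOfIdeal I, ?_, ?_, ?_⟩
  · refine le_trans ?_ (inf_le_left : I ≤ k)
    unfold derivedAbelianOfIdeal
    split
    · exact bot_le
    · exact derivedSeriesOfIdeal_le_self I _
  · rwa [Ne, abelian_of_solvable_ideal_eq_bot_iff]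
  · have := abelian_derivedAbelianOfIdeal I
    intro x hx y hy
    have h := this.trivial ⟨x, hx⟩ ⟨y, hy⟩
    exact congrArg Subtype.val h

end SymplecticForm

/-! ### Irreducible algebras and the splitting along an abelian ideal -/

namespace SymplecticForm

variable {𝔤 : Type*} [LieRing 𝔤] [LieAlgebra ℝ 𝔤]

/-- A symplectic Lie algebra is irreducible if it has no nonzero isotropic ideal. -/
def IsIrreducible (ω : SymplecticForm 𝔤) : Prop :=
  ∀ j : LieIdeal ℝ 𝔤, ω.IsIsotropic j → j = ⊥

/-- The term with `[b,c]` drops out of the closedness identity. This infinitesimal symplecticity is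
the source of every later constraint on the action on `a`. -/
theorem form_lie_of_abelian (ω : SymplecticForm 𝔤) {a : LieIdeal ℝ 𝔤}
    (ha : ∀ x ∈ a, ∀ y ∈ a, ⁅x, y⁆ = 0) (x : 𝔤) {b c : 𝔤} (hb : b ∈ a) (hc : c ∈ a) :
    ω.form ⁅x, b⁆ c = - ω.form b ⁅x, c⁆ := by
  have h := ω.closed x b c
  rw [ha b hb c hc, ← lie_skew c x, map_neg, LinearMap.neg_apply, ω.form_swap ⁅x, c⁆] at h
  simp at h
  linarith

/-- Skewness makes `a ∩ a^⊥` an ideal, and it is visibly isotropic. Hence abelian ideals are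
symplectic subspaces. -/
theorem IsIrreducible.eq_zero_of_mem_orth {ω : SymplecticForm 𝔤} (hω : ω.IsIrreducible)
    {a : LieIdeal ℝ 𝔤} (ha : ∀ x ∈ a, ∀ y ∈ a, ⁅x, y⁆ = 0) {x : 𝔤} (hx : x ∈ a)
    (hx' : x ∈ ω.orth a) : x = 0 := by
  let I : LieIdeal ℝ 𝔤 :=
    { a.toSubmodule ⊓ (ω.orth a).toSubmodule with
      lie_mem := by
        rintro y b ⟨hb, hb'⟩
        refine ⟨lie_mem_right ℝ 𝔤 a y b hb, fun c hc => ?_⟩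
        rw [ω.form_lie_of_abelian ha y hb hc, hb' _ (lie_mem_right ℝ 𝔤 a y c hc), neg_zero] }
  have hI : I = ⊥ := hω I fun y hy c hc => hy.2 c hc.1
  have : x ∈ I := ⟨hx, hx'⟩
  rw [hI] at this
  simpa using this

theorem IsIrreducible.eq_zero_of_lie_eq_smul {ω : SymplecticForm 𝔤} (hω : ω.IsIrreducible)
    {x : 𝔤} (hx : ∀ y : 𝔤, ∃ c : ℝ, ⁅y, x⁆ = c • x) : x = 0 := by
  let I : LieIdeal ℝ 𝔤 :=
    { Submodule.span ℝ {x} with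
      lie_mem := by
        intro y b hb
        obtain ⟨r, rfl⟩ := Submodule.mem_span_singleton.1 hb
        obtain ⟨c, hc⟩ := hx y
        rw [lie_smul, hc]
        exact Submodule.smul_mem _ _ (Submodule.smul_mem _ _ (Submodule.mem_span_singleton_self x)) }
  have hI : I = ⊥ := hω I fun y hy c hc => by
    obtain ⟨r, rfl⟩ := Submodule.mem_span_singleton.1 hy
    obtain ⟨s, rfl⟩ := Submodule.mem_span_singleton.1 hc
    simp [ω.alt x]
  have : x ∈ I := Submodule.mem_span_singleton_self x
  rw [hI] at this
  simpa using this

theorem toSubmodule_orth (ω : SymplecticForm 𝔤) (j : LieIdeal ℝ 𝔤) :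
    (ω.orth j).toSubmodule = ω.form.orthogonal j.toSubmodule := by
  ext x
  exact ⟨fun h y hy => ω.alt.isRefl _ _ (h y hy), fun h y hy => ω.alt.isRefl _ _ (h y hy)⟩

theorem finrank_orth [FiniteDimensional ℝ 𝔤] (ω : SymplecticForm 𝔤) (j : LieIdeal ℝ 𝔤) :
    Module.finrank ℝ j + Module.finrank ℝ (ω.orth j) = Module.finrank ℝ 𝔤 := by
  have h := LinearMap.BilinForm.finrank_orthogonal ω.nondegenerate j.toSubmodule
  rw [← toSubmodule_orth] at h
  have h' := Submodule.finrank_le j.toSubmodule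
  change Module.finrank ℝ (ω.orth j) = _ - Module.finrank ℝ j at h
  change Module.finrank ℝ j ≤ _ at h'
  omega

theorem IsIrreducible.exists_add [FiniteDimensional ℝ 𝔤] {ω : SymplecticForm 𝔤}
    (hω : ω.IsIrreducible)
    {a : LieIdeal ℝ 𝔤} (ha : ∀ x ∈ a, ∀ y ∈ a, ⁅x, y⁆ = 0) (v : 𝔤) :
    ∃ b ∈ a, ∃ x ∈ ω.orth a, b + x = v := by
  have h : IsCompl a.toSubmodule (ω.form.orthogonal a.toSubmodule) := by
    rw [LinearMap.BilinForm.isCompl_orthogonal_iff_disjoint ω.alt.isRefl, ← toSubmodule_orth,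
      Submodule.disjoint_def]
    exact fun x hx hx' => hω.eq_zero_of_mem_orth ha hx hx'
  have hv : v ∈ a.toSubmodule ⊔ ω.form.orthogonal a.toSubmodule := by
    rw [h.sup_eq_top]; trivial
  rw [← toSubmodule_orth, Submodule.mem_sup] at hv
  exact hv

/-- A subspace of an abelian ideal `a` which is invariant under `a^⊥` is an ideal. -/
theorem IsIrreducible.exists_ideal [FiniteDimensional ℝ 𝔤] {ω : SymplecticForm 𝔤}
    (hω : ω.IsIrreducible)
    {a : LieIdeal ℝ 𝔤} (ha : ∀ x ∈ a, ∀ y ∈ a, ⁅x, y⁆ = 0) {W : Submodule ℝ 𝔤}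
    (hW : W ≤ a.toSubmodule) (h : ∀ x ∈ ω.orth a, ∀ w ∈ W, ⁅x, w⁆ ∈ W) :
    ∃ I : LieIdeal ℝ 𝔤, I.toSubmodule = W := by
  refine ⟨{ W with lie_mem := ?_ }, rfl⟩
  intro y w hw
  obtain ⟨b, hb, x, hx, rfl⟩ := hω.exists_add ha y
  rw [add_lie, ha b hb w (hW hw), zero_add]
  exact h x hx w hw

/-- In an irreducible symplectic Lie algebra the orthogonal of a maximal abelian ideal acts
faithfully on it. -/
theorem IsIrreducible.exists_faithful [FiniteDimensional ℝ 𝔤] {ω : SymplecticForm 𝔤}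
    (hω : ω.IsIrreducible) : ∃ a : LieIdeal ℝ 𝔤, (∀ x ∈ a, ∀ y ∈ a, ⁅x, y⁆ = 0) ∧
      ∀ x ∈ ω.orth a, (∀ y ∈ a, ⁅x, y⁆ = 0) → x = 0 := by
  obtain ⟨a, ha, hmax⟩ := (wellFounded_gt (α := LieIdeal ℝ 𝔤)).has_min
    {a | ∀ x ∈ a, ∀ y ∈ a, ⁅x, y⁆ = 0} ⟨⊥, by
      intro x hx y hy
      rw [(LieSubmodule.mem_bot x).1 hx, zero_lie]⟩
  refine ⟨a, ha, ?_⟩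
  -- The centralizer of `a` in `a^⊥` is an ideal because `𝔤 = a + a^⊥` and its elements commute with
  -- `a`.
  let k : LieIdeal ℝ 𝔤 :=
    { carrier := {x | x ∈ ω.orth a ∧ ∀ y ∈ a, ⁅x, y⁆ = 0}
      add_mem' := by
        rintro x y ⟨hx, hx'⟩ ⟨hy, hy'⟩
        exact ⟨add_mem hx hy, fun z hz => by rw [add_lie, hx' z hz, hy' z hz, add_zero]⟩
      zero_mem' := ⟨zero_mem _, fun z _ => zero_lie z⟩
      smul_mem' := by
        rintro c x ⟨hx, hx'⟩
        exact ⟨(ω.orth a).smul_mem c hx, fun z hz => by rw [smul_lie, hx' z hz, smul_zero]⟩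
      lie_mem := by
        rintro v x ⟨hx, hx'⟩
        obtain ⟨b, hb, y, hy, rfl⟩ := hω.exists_add ha v
        have h0 : ⁅b + y, x⁆ = ⁅y, x⁆ := by
          rw [add_lie, ← lie_skew, hx' b hb, neg_zero, zero_add]
        have h1 : ⁅y, x⁆ ∈ ω.orth a := (ω.orth a).lie_mem hy hx
        refine ⟨h0 ▸ h1, fun z hz => ?_⟩
        rw [h0, lie_lie, hx' z hz, hx' _ (lie_mem_right ℝ 𝔤 a y z hz), lie_zero, sub_zero] }
  by_contra hne
  push Not at hne
  obtain ⟨x, hx, hx', hx0⟩ := hne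
  have hk : k ≠ ⊥ := by
    intro h
    have : x ∈ k := ⟨hx, hx'⟩
    rw [h] at this
    exact hx0 (by simpa using this)
  obtain ⟨b, hbk, hb0, hb⟩ := ω.exists_abelian_le k hk
  -- An abelian ideal inside the centralizer can be added to `a`; maximality puts it in `a ∩ a^⊥ =
  -- 0`.
  have hab : ∀ x ∈ a ⊔ b, ∀ y ∈ a ⊔ b, ⁅x, y⁆ = 0 := by
    intro x hx y hy
    rw [LieSubmodule.mem_sup] at hx hy
    obtain ⟨x1, hx1, x2, hx2, rfl⟩ := hx
    obtain ⟨y1, hy1, y2, hy2, rfl⟩ := hy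
    rw [add_lie, lie_add, lie_add, ha _ hx1 _ hy1, hb _ hx2 _ hy2, (hbk hx2).2 _ hy1,
      ← lie_skew, (hbk hy2).2 _ hx1]
    simp
  have hle : b ≤ a := by
    by_contra hba
    exact hmax (a ⊔ b) hab (lt_of_le_of_ne le_sup_left fun h => hba (h ▸ le_sup_right))
  apply hb0
  rw [eq_bot_iff]
  intro y hy
  rw [LieSubmodule.mem_bot]
  exact hω.eq_zero_of_mem_orth ha (hle hy) (hbk hy).1

/-- A skew-symmetric matrix of odd size has determinant zero. -/
theorem even_finrank [FiniteDimensional ℝ 𝔤] (ω : SymplecticForm 𝔤) (W : Submodule ℝ 𝔤)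
    (hW : ∀ x ∈ W, (∀ y ∈ W, ω.form x y = 0) → x = 0) : Even (Module.finrank ℝ W) := by
  set b := Module.finBasis ℝ W
  have halt : (ω.form.restrict W).IsAlt := fun x => ω.alt x
  have hnd : (ω.form.restrict W).Nondegenerate := by
    refine halt.isRefl.nondegenerate_iff_separatingLeft.mpr ?_
    intro x hx
    exact Subtype.ext (hW x x.2 fun y hy => hx ⟨y, hy⟩)
  have hdet := (LinearMap.BilinForm.nondegenerate_iff_det_ne_zero b).1 hnd
  set M := LinearMap.BilinForm.toMatrix b (ω.form.restrict W) with hM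
  have hT : M.transpose = -M := by
    ext i j
    simp only [hM, Matrix.transpose_apply, Matrix.neg_apply, LinearMap.BilinForm.toMatrix_apply]
    exact ω.form_swap _ _
  have h := M.det_transpose
  rw [hT, Matrix.det_neg, Fintype.card_fin] at h
  by_contra hodd
  rw [Nat.not_even_iff_odd] at hodd
  rw [hodd.neg_one_pow] at h
  apply hdet
  linarith

end SymplecticForm

/-! ### The orthogonal of a faithful abelian ideal is an abelian plane -/

namespace SymplecticForm

variable {𝔤 : Type*} [LieRing 𝔤] [LieAlgebra ℝ 𝔤] [FiniteDimensional ℝ 𝔤]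

theorem IsIrreducible.even_finrank_ideal {ω : SymplecticForm 𝔤} (hω : ω.IsIrreducible)
    {a : LieIdeal ℝ 𝔤} (ha : ∀ x ∈ a, ∀ y ∈ a, ⁅x, y⁆ = 0) : Even (Module.finrank ℝ a) :=
  ω.even_finrank a.toSubmodule fun _ hx hx' => hω.eq_zero_of_mem_orth ha hx hx'

theorem even_finrank_top (ω : SymplecticForm 𝔤) : Even (Module.finrank ℝ 𝔤) := by
  have := ω.even_finrank ⊤ fun x _ hx => ω.eq_zero_of_form_eq_zero fun y => hx y trivial
  rwa [finrank_top] at this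

/-- A faithful symplectic action of `a^⊥` on a two-dimensional abelian ideal `a` bounds the dimension
of `a^⊥` by that of `𝔰𝔭(2)`. -/
theorem finrank_orth_le_three {ω : SymplecticForm 𝔤}
    (hω : ω.IsIrreducible) {a : LieIdeal ℝ 𝔤} (ha : ∀ x ∈ a, ∀ y ∈ a, ⁅x, y⁆ = 0)
    (hf : ∀ x ∈ ω.orth a, (∀ y ∈ a, ⁅x, y⁆ = 0) → x = 0) (h2 : Module.finrank ℝ a = 2) :
    Module.finrank ℝ (ω.orth a) ≤ 3 := by
  let b : Module.Basis (Fin 2) ℝ a := Module.finBasisOfFinrankEq ℝ a h2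
  have hspan : ∀ y ∈ a, ∃ p q : ℝ, y = p • (b 0 : 𝔤) + q • (b 1 : 𝔤) := by
    intro y hy
    have h := b.sum_repr ⟨y, hy⟩
    rw [Fin.sum_univ_two] at h
    exact ⟨_, _, (congrArg Subtype.val h).symm⟩
  -- Skewness makes `(u, v) ↦ ω(v, [u,x])` symmetric, so on a plane its three independent values
  -- determine the action of `x`.
  let q : 𝔤 → 𝔤 → (ω.orth a →ₗ[ℝ] ℝ) := fun u v =>
    (ω.form v) ∘ₗ (ad ℝ 𝔤 u) ∘ₗ (ω.orth a).toSubmodule.subtype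
  have hq : ∀ u v x, q u v x = ω.form v ⁅u, (x : 𝔤)⁆ := fun u v x => rfl
  let F : ω.orth a →ₗ[ℝ] (Fin 3 → ℝ) :=
    LinearMap.pi ![q (b 0) (b 0), q (b 0) (b 1), q (b 1) (b 1)]
  have hF : Function.Injective F := by
    rw [← LinearMap.ker_eq_bot, LinearMap.ker_eq_bot']
    intro x hx
    have h0 : q (b 0) (b 0) x = 0 := congrFun hx 0
    have h1 : q (b 0) (b 1) x = 0 := congrFun hx 1
    have h3 : q (b 1) (b 1) x = 0 := congrFun hx 2
    rw [hq] at h0 h1 h3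
    have h4 : ω.form (b 0 : 𝔤) ⁅(b 1 : 𝔤), (x : 𝔤)⁆ = 0 := by
      have h := ω.form_lie_of_abelian ha x (b 0).2 (b 1).2
      rw [← lie_skew (x : 𝔤) (b 0 : 𝔤), ← lie_skew (x : 𝔤) (b 1 : 𝔤), map_neg, map_neg, LinearMap.neg_apply,
        ω.form_swap ⁅(b 0 : 𝔤), (x : 𝔤)⁆, h1] at h
      linarith
    have key : ∀ u ∈ a, ω.form (b 0 : 𝔤) ⁅u, (x : 𝔤)⁆ = 0 → ω.form (b 1 : 𝔤) ⁅u, (x : 𝔤)⁆ = 0 →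
        ⁅u, (x : 𝔤)⁆ = 0 := by
      intro u hu e0 e1
      apply hω.eq_zero_of_mem_orth ha (lie_mem_left ℝ 𝔤 a u x hu)
      intro y hy
      obtain ⟨p, q, rfl⟩ := hspan y hy
      rw [ω.form_swap, map_add, map_smul, map_smul, LinearMap.add_apply, LinearMap.smul_apply,
        LinearMap.smul_apply, e0, e1]
      simp
    apply Subtype.ext
    apply hf x x.2
    intro y hy
    obtain ⟨p, q, rfl⟩ := hspan y hy
    rw [← lie_skew, add_lie, smul_lie, smul_lie, key _ (b 0).2 h0 h1, key _ (b 1).2 h4 h3]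
    simp
  have := LinearMap.finrank_le_finrank_of_injective hF
  simpa using this

/-- Both `a` and `a^⊥` are nonzero of even dimension with sum at most six. The only other case,
dimensions two and four, violates the bound by `𝔰𝔭(2)`. -/
theorem IsIrreducible.finrank_orth_eq_two [Nontrivial 𝔤] {ω : SymplecticForm 𝔤}
    (hω : ω.IsIrreducible) (hdim : Module.finrank ℝ 𝔤 ≤ 6)
    {a : LieIdeal ℝ 𝔤} (ha : ∀ x ∈ a, ∀ y ∈ a, ⁅x, y⁆ = 0)
    (hf : ∀ x ∈ ω.orth a, (∀ y ∈ a, ⁅x, y⁆ = 0) → x = 0) :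
    Module.finrank ℝ (ω.orth a) = 2 := by
  have h1 := ω.finrank_orth a
  obtain ⟨m, hm⟩ := hω.even_finrank_ideal ha
  obtain ⟨n, hn⟩ := ω.even_finrank_top
  obtain ⟨v, hv⟩ := exists_ne (0 : 𝔤)
  have h2 : Module.finrank ℝ a ≠ 0 := by
    intro h
    apply hv
    have hz : ∀ y ∈ a, y = 0 := by
      intro y hy
      have : a.toSubmodule = ⊥ := Submodule.finrank_eq_zero.1 h
      have hy' : y ∈ a.toSubmodule := hy
      rw [this] at hy'
      simpa using hy'
    refine hf v (fun y hy => ?_) fun y hy => ?_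
    · rw [hz y hy, map_zero]
    · rw [hz y hy, lie_zero]
  have h3 : Module.finrank ℝ (ω.orth a) ≠ 0 := by
    intro h
    apply hv
    have hz : (ω.orth a).toSubmodule = ⊥ := Submodule.finrank_eq_zero.1 h
    have hall : ∀ x : 𝔤, x ∈ a := by
      intro x
      obtain ⟨b, hb, y, hy, rfl⟩ := hω.exists_add ha x
      have hy' : y ∈ (ω.orth a).toSubmodule := hy
      rw [hz, Submodule.mem_bot] at hy'
      simpa [hy'] using hb
    apply hω.eq_zero_of_lie_eq_smul
    intro y
    exact ⟨0, by rw [ha y (hall y) v (hall v), zero_smul]⟩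
  have h4 : Module.finrank ℝ a = 2 → Module.finrank ℝ (ω.orth a) ≤ 3 :=
    finrank_orth_le_three hω ha hf
  by_cases h5 : Module.finrank ℝ a = 2
  · have := h4 h5
    omega
  · omega

/-- A two-dimensional orthogonal of an abelian ideal, acting faithfully on it, is abelian. -/
theorem IsIrreducible.lie_orth_eq_zero {ω : SymplecticForm 𝔤}
    (hω : ω.IsIrreducible) {a : LieIdeal ℝ 𝔤} (ha : ∀ x ∈ a, ∀ y ∈ a, ⁅x, y⁆ = 0)
    (hf : ∀ x ∈ ω.orth a, (∀ y ∈ a, ⁅x, y⁆ = 0) → x = 0)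
    (h2 : Module.finrank ℝ (ω.orth a) = 2) :
    ∀ x ∈ ω.orth a, ∀ y ∈ ω.orth a, ⁅x, y⁆ = 0 := by
  intro u hu v hv
  by_contra hz0
  set z := ⁅u, v⁆ with hz
  have hzh : z ∈ ω.orth a := (ω.orth a).lie_mem hu hv
  have hli : LinearIndependent ℝ ![(⟨u, hu⟩ : ω.orth a), ⟨v, hv⟩] := by
    rw [LinearIndependent.pair_iff]
    intro s t hst
    have hst' : s • u + t • v = 0 := congrArg Subtype.val hst
    have h1 : ⁅s • u + t • v, v⁆ = s • z := by simp [hz]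
    have h2 : ⁅u, s • u + t • v⁆ = t • z := by simp [hz]
    rw [hst', zero_lie] at h1
    rw [hst', lie_zero] at h2
    exact ⟨(smul_eq_zero.1 h1.symm).resolve_right hz0, (smul_eq_zero.1 h2.symm).resolve_right hz0⟩
  have hspan : ∀ x ∈ ω.orth a, ∃ p q : ℝ, x = p • u + q • v := by
    intro x hx
    let b := basisOfLinearIndependentOfCardEqFinrank hli (by simp [h2])
    have h := b.sum_repr ⟨x, hx⟩
    rw [Fin.sum_univ_two] at h
    simp only [b, coe_basisOfLinearIndependentOfCardEqFinrank] at h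
    exact ⟨_, _, (congrArg Subtype.val h).symm⟩
  obtain ⟨α, β, hαβ⟩ := hspan z hzh
  have hact : ∀ p q : ℝ, ⁅p • u + q • v, z⁆ = (p * β - q * α) • z := by
    intro p q
    have h1 : ⁅u, z⁆ = β • z := by
      rw [hαβ, lie_add, lie_smul, lie_smul, lie_self, ← hz, smul_zero, zero_add, ← hαβ]
    have h3 : ⁅v, z⁆ = -α • z := by
      rw [hαβ, lie_add, lie_smul, lie_smul, lie_self, ← lie_skew, ← hz, smul_zero, add_zero,
        ← hαβ, smul_neg, neg_smul]
    rw [add_lie, smul_lie, smul_lie, h1, h3]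
    module
  have hact' : ∀ x ∈ ω.orth a, ∃ c : ℝ, ⁅x, z⁆ = c • z := by
    intro x hx
    obtain ⟨p, q, rfl⟩ := hspan x hx
    exact ⟨_, hact p q⟩
  -- With `z = αu + βv` nonzero, a multiple of `u` or of `v` acts on `z` as the identity, so `a^⊥`
  -- is the affine Lie algebra of the line.
  obtain ⟨w, hw, hwz⟩ : ∃ w ∈ ω.orth a, ⁅w, z⁆ = z := by
    by_cases hβ : β = 0
    · have hα : α ≠ 0 := by
        rintro rfl
        apply hz0
        rw [hαβ, hβ]
        simp
      refine ⟨(0 : ℝ) • u + (-α⁻¹) • v, add_mem ((ω.orth a).smul_mem _ hu)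
        ((ω.orth a).smul_mem _ hv), ?_⟩
      rw [hact]
      field_simp
      simp
    · refine ⟨β⁻¹ • u + (0 : ℝ) • v, add_mem ((ω.orth a).smul_mem _ hu)
        ((ω.orth a).smul_mem _ hv), ?_⟩
      rw [hact]
      field_simp
      simp
  obtain ⟨N, hN⟩ := hω.exists_ideal ha
    (W := a.toSubmodule ⊓ LinearMap.ker (ad ℝ 𝔤 z)) inf_le_left (by
      rintro x hx b ⟨hb, hb'⟩
      have hb'' : ⁅z, b⁆ = 0 := hb'
      refine ⟨lie_mem_right ℝ 𝔤 a x b hb, ?_⟩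
      obtain ⟨c, hc⟩ := hact' x hx
      change ⁅z, ⁅x, b⁆⁆ = 0
      rw [leibniz_lie, hb'', lie_zero, add_zero, ← lie_skew z x, hc]
      simp [hb''])
  have hNmem : ∀ b, b ∈ N ↔ b ∈ a ∧ ⁅z, b⁆ = 0 := by
    intro b
    rw [← LieSubmodule.mem_toSubmodule, hN]
    rfl
  have hNa : ∀ x ∈ N, ∀ y ∈ N, ⁅x, y⁆ = 0 := fun x hx y hy =>
    ha x ((hNmem x).1 hx).1 y ((hNmem y).1 hy).1
  -- The complement in `a` of the kernel `N` of `ad z`; there `ad z` is injective because `N ∩ N^⊥ =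
  -- 0`.
  obtain ⟨N', hN'⟩ := hω.exists_ideal ha
    (W := a.toSubmodule ⊓ (ω.orth N).toSubmodule) inf_le_left (by
      rintro x hx b ⟨hb, hb'⟩
      refine ⟨lie_mem_right ℝ 𝔤 a x b hb, fun y hy => ?_⟩
      rw [ω.form_lie_of_abelian ha x hb ((hNmem y).1 hy).1, hb' _ (lie_mem_right ℝ 𝔤 N x y hy),
        neg_zero])
  have hN'mem : ∀ b, b ∈ N' ↔ b ∈ a ∧ b ∈ ω.orth N := by
    intro b
    rw [← LieSubmodule.mem_toSubmodule, hN']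
    rfl
  let Z : Module.End ℝ N' := LieModule.toEnd ℝ 𝔤 N' z
  let W : Module.End ℝ N' := LieModule.toEnd ℝ 𝔤 N' w
  have hZinj : Function.Injective Z := by
    rw [← LinearMap.ker_eq_bot, LinearMap.ker_eq_bot']
    intro b hb
    have hb' : ⁅z, (b : 𝔤)⁆ = 0 := congrArg Subtype.val hb
    obtain ⟨h1, h2⟩ := (hN'mem b).1 b.2
    exact Subtype.ext (hω.eq_zero_of_mem_orth hNa ((hNmem _).2 ⟨h1, hb'⟩) h2)
  have hcomm : W * Z = Z * W + Z := by
    ext b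
    change ⁅w, ⁅z, (b : 𝔤)⁆⁆ = ⁅z, ⁅w, (b : 𝔤)⁆⁆ + ⁅z, (b : 𝔤)⁆
    rw [leibniz_lie, hwz, add_comm]
  have hunit : IsUnit Z := by
    rw [Module.End.isUnit_iff]
    exact ⟨hZinj, LinearMap.injective_iff_surjective.1 hZinj⟩
  obtain ⟨Y, hY⟩ := hunit.exists_right_inv
  -- From `WZ = ZW + Z` with `Z` invertible, `W - ZWZ⁻¹ = 1`; taking traces gives `dim N' = 0`.
  have htr : LinearMap.trace ℝ N' (W * Z * Y) = LinearMap.trace ℝ N' (Z * W * Y) +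
      LinearMap.trace ℝ N' 1 := by
    rw [hcomm, add_mul, hY, map_add]
  have hY' : Y * Z = 1 := by
    obtain ⟨Y', hY'⟩ := hunit.exists_left_inv
    have : Y' = Y := by
      calc Y' = Y' * (Z * Y) := by rw [hY, mul_one]
        _ = Y := by rw [← mul_assoc, hY', one_mul]
    rw [← this, hY']
  rw [mul_assoc, hY, mul_one, LinearMap.trace_mul_comm, ← mul_assoc, hY', one_mul,
    LinearMap.trace_one] at htr
  have hdim0 : Module.finrank ℝ N' = 0 := by
    have : (Module.finrank ℝ N' : ℝ) = 0 := by linarith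
    exact_mod_cast this
  have hN'bot : N'.toSubmodule = ⊥ := Submodule.finrank_eq_zero.1 hdim0
  apply hz0
  apply hf z hzh
  intro b hb
  obtain ⟨n, hn, m, hm, rfl⟩ := hω.exists_add hNa b
  have hn' := (hNmem n).1 hn
  have hma : m ∈ a := by simpa using sub_mem hb hn'.1
  have : m ∈ N'.toSubmodule := (hN'mem m).2 ⟨hma, hm⟩
  rw [hN'bot, Submodule.mem_bot] at this
  rw [this, add_zero, hn'.2]

end SymplecticForm

/-! ### Minimal ideals are planes of rotations -/

namespace SymplecticForm

open Polynomial

variable {𝔤 : Type*} [LieRing 𝔤] [LieAlgebra ℝ 𝔤]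

/-- Schur's lemma for minimal ideals. -/
theorem _root_.LieIdeal.eq_zero_or_injective_of_isAtom {W : LieIdeal ℝ 𝔤} (hW : IsAtom W)
    (f : Module.End ℝ W) (hf : ∀ (y : 𝔤) (w : W), f ⁅y, w⁆ = ⁅y, f w⁆) :
    f = 0 ∨ Function.Injective f := by
  let K : LieIdeal ℝ 𝔤 :=
    { (LinearMap.ker f).map W.toSubmodule.subtype with
      lie_mem := by
        rintro y _ ⟨(w : W), hw, rfl⟩
        have hw' : f w = 0 := hw
        refine ⟨(⁅y, (w : W)⁆ : W), ?_, rfl⟩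
        exact (hf y w).trans (by rw [hw', lie_zero]) }
  have hmem : ∀ w : W, (w : 𝔤) ∈ K ↔ f w = 0 := by
    intro w
    constructor
    · rintro ⟨w', hw', h⟩
      have : w' = w := Subtype.ext h
      rw [← this]
      exact hw'
    · intro h
      exact ⟨w, h, rfl⟩
  have hKW : K ≤ W := by
    rintro _ ⟨w, -, rfl⟩
    exact w.2
  rcases hW.le_iff.1 hKW with h | h
  · right
    rw [← LinearMap.ker_eq_bot, LinearMap.ker_eq_bot']
    intro w hw
    have := (hmem w).2 hw
    rw [h, LieSubmodule.mem_bot] at this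
    exact Subtype.ext this
  · left
    ext w
    have : (w : 𝔤) ∈ K := by rw [h]; exact w.2
    rw [(hmem w).1 this]
    rfl

/-- A real endomorphism of a nonzero space is annihilated on a nonzero subspace by a monic
irreducible polynomial. -/
theorem exists_irreducible_aeval_not_injective {V : Type*} [AddCommGroup V] [Module ℝ V]
    [FiniteDimensional ℝ V] [Nontrivial V] (A : Module.End ℝ V) :
    ∃ p : ℝ[X], p.Monic ∧ Irreducible p ∧ ¬ Function.Injective (aeval A p) := by
  have hint : IsIntegral ℝ A := Algebra.IsIntegral.isIntegral A
  obtain ⟨p, hp, hirr, q, hq⟩ := Polynomial.exists_monic_irreducible_factor (minpoly ℝ A)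
    (minpoly.not_isUnit ℝ A)
  refine ⟨p, hp, hirr, fun hinj => ?_⟩
  -- If `p(A)` were injective, `q(A)` would vanish although `q` has smaller degree than the minimal
  -- polynomial `pq`.
  have h0 : aeval A p * aeval A q = 0 := by
    rw [← map_mul, ← hq, minpoly.aeval]
  have hq0 : aeval A q = 0 := by
    ext v
    exact hinj (by simpa using congrArg (fun F : Module.End ℝ V => F v) h0)
  have hqne : q ≠ 0 := by
    rintro rfl
    exact minpoly.ne_zero hint (by rw [hq, mul_zero])
  have h1 := minpoly.degree_le_of_ne_zero ℝ A hqne hq0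
  rw [hq, degree_mul] at h1
  have h2 := Polynomial.degree_pos_of_irreducible hirr
  rw [degree_eq_natDegree hqne, degree_eq_natDegree hirr.ne_zero] at h1
  rw [degree_eq_natDegree hirr.ne_zero] at h2
  norm_cast at h1 h2
  omega

variable [FiniteDimensional ℝ 𝔤] {ω : SymplecticForm 𝔤}

/-- On `W` the operator `ad x` commutes with all of `𝔤`, so by Schur a real irreducible polynomial,
of degree one or two, annihilates it. Skewness for the nondegenerate form on `W` removes every case
except `ad x = 0` and a square that is a nonpositive scalar. -/
theorem IsIrreducible.exists_sq_eq (hω : ω.IsIrreducible) {a : LieIdeal ℝ 𝔤}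
    (ha : ∀ x ∈ a, ∀ y ∈ a, ⁅x, y⁆ = 0) (hh : ∀ x ∈ ω.orth a, ∀ y ∈ ω.orth a, ⁅x, y⁆ = 0)
    {W : LieIdeal ℝ 𝔤} (hW : IsAtom W) (hWa : W ≤ a) {x : 𝔤} (hx : x ∈ ω.orth a) :
    ∃ q : ℝ, 0 ≤ q ∧ ∀ w ∈ W, ⁅x, ⁅x, w⁆⁆ = -q • w := by
  have hWW : ∀ x ∈ W, ∀ y ∈ W, ⁅x, y⁆ = 0 := fun x hx y hy => ha x (hWa hx) y (hWa hy)
  have hnt : Nontrivial W := (LieSubmodule.nontrivial_iff_ne_bot ℝ 𝔤 𝔤).2 hW.1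
  let A : Module.End ℝ W := LieModule.toEnd ℝ 𝔤 W x
  have hA : ∀ w, A w = ⁅x, w⁆ := fun w => rfl
  have hAcomm : ∀ (y : 𝔤) (w : W), A ⁅y, w⁆ = ⁅y, A w⁆ := by
    intro y w
    obtain ⟨b, hb, z, hz, rfl⟩ := hω.exists_add ha y
    apply Subtype.ext
    change ⁅x, ⁅b + z, (w : 𝔤)⁆⁆ = ⁅b + z, ⁅x, (w : 𝔤)⁆⁆
    rw [add_lie, add_lie, ha b hb _ (hWa w.2),
      ha b hb _ (hWa (lie_mem_right ℝ 𝔤 W x w w.2)), zero_add, zero_add,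
      leibniz_lie x z, hh x hx z hz]
    rw [zero_lie, zero_add]
  have hskew : ∀ u ∈ W, ∀ v ∈ W, ω.form ⁅x, u⁆ v = - ω.form u ⁅x, v⁆ := fun u hu v hv =>
    ω.form_lie_of_abelian hWW x hu hv
  have hlie : ∀ u ∈ W, ⁅x, u⁆ ∈ W := fun u hu => lie_mem_right ℝ 𝔤 W x u hu
  obtain ⟨p, hp, hirr, hinj⟩ := exists_irreducible_aeval_not_injective A
  have hpA : aeval A p = 0 := by
    refine (LieIdeal.eq_zero_or_injective_of_isAtom hW (aeval A p) ?_).resolve_right hinj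
    intro y w
    have hc : Commute A (LieModule.toEnd ℝ 𝔤 W y) := by
      ext w
      exact congrArg Subtype.val (hAcomm y w)
    have hc' : Commute (aeval A p) (LieModule.toEnd ℝ 𝔤 W y) :=
      (Algebra.commute_of_mem_adjoin_singleton_of_commute
        (aeval_mem_adjoin_singleton ℝ A) hc.symm).symm
    exact congrArg (fun F : Module.End ℝ W => F w) hc'.eq
  have hzero : (∀ w ∈ W, ⁅x, w⁆ = 0) →
      ∃ q : ℝ, 0 ≤ q ∧ ∀ w ∈ W, ⁅x, ⁅x, w⁆⁆ = -q • w := by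
    intro h
    exact ⟨0, le_rfl, fun w hw => by rw [h w hw, lie_zero, neg_zero, zero_smul]⟩
  have hdeg : p.natDegree ≤ 2 := hirr.natDegree_le_two
  have hdeg' : 0 < p.natDegree := hirr.natDegree_pos
  have hsum : aeval A p = ∑ i ∈ Finset.range (p.natDegree + 1), p.coeff i • A ^ i :=
    aeval_eq_sum_range A
  rw [hpA] at hsum
  rcases (by omega : p.natDegree = 1 ∨ p.natDegree = 2) with h1 | h1
  · apply hzero
    have hc1 : p.coeff 1 = 1 := by rw [← h1]; exact hp
    rw [h1] at hsum
    simp only [Finset.sum_range_succ, Finset.sum_range_zero, hc1] at hsum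
    have hev : ∀ w ∈ W, ⁅x, w⁆ = -p.coeff 0 • w := by
      intro w hw
      have := congrArg (fun F : Module.End ℝ W => ((F ⟨w, hw⟩ : W) : 𝔤)) hsum
      simp [hA] at this
      rw [neg_smul, eq_neg_iff_add_eq_zero, add_comm]
      exact this.symm
    intro w hw
    apply hω.eq_zero_of_mem_orth hWW (hlie w hw)
    intro v hv
    have h2 := hskew w hw v hv
    rw [hev w hw, hev v hv] at h2
    rw [hev w hw]
    simp at h2 ⊢
    by_contra hne
    push Not at hne
    have : p.coeff 0 * ω.form w v = 0 := by linarith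
    exact (mul_ne_zero hne.1 hne.2) this
  · have hc2 : p.coeff 2 = 1 := by rw [← h1]; exact hp
    rw [h1] at hsum
    simp only [Finset.sum_range_succ, Finset.sum_range_zero, hc2] at hsum
    have hev : ∀ w ∈ W, ⁅x, ⁅x, w⁆⁆ = -p.coeff 0 • w - p.coeff 1 • ⁅x, w⁆ := by
      intro w hw
      have := congrArg (fun F : Module.End ℝ W => ((F ⟨w, hw⟩ : W) : 𝔤)) hsum
      simp [hA, pow_two] at this
      rw [neg_smul, ← sub_eq_zero, this]
      abel
    by_cases hb : p.coeff 1 = 0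
    · refine ⟨p.coeff 0, ?_, fun w hw => by rw [hev w hw, hb, zero_smul, sub_zero]⟩
      by_contra hneg
      push Not at hneg
      -- A negative constant term would give the irreducible quadratic a real root.
      have hroot : p.IsRoot (√(-p.coeff 0)) := by
        rw [IsRoot.def, eval_eq_sum_range, h1]
        simp only [Finset.sum_range_succ, Finset.sum_range_zero, hc2, hb]
        rw [Real.sq_sqrt (by linarith)]
        ring
      have := Polynomial.degree_eq_one_of_irreducible_of_root hirr hroot
      rw [degree_eq_natDegree hirr.ne_zero, h1] at this
      norm_num at this
    -- `A²` is `ω`-symmetric and `A` is `ω`-skew, so the linear term of the quadratic relation must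
    -- vanish.
    · apply hzero
      intro w hw
      apply hω.eq_zero_of_mem_orth hWW (hlie w hw)
      intro v hv
      have h2 := hskew ⁅x, w⁆ (hlie w hw) v hv
      rw [hskew w hw _ (hlie v hv), hev w hw, hev v hv] at h2
      have h3 := hskew w hw v hv
      simp at h2
      have : p.coeff 1 * ω.form ⁅x, w⁆ v = 0 := by
        have h4 : ω.form w ⁅x, v⁆ = - ω.form ⁅x, w⁆ v := by linarith
        rw [h4] at h2
        linarith
      exact (mul_eq_zero.1 this).resolve_left hb

/-- A minimal ideal contained in an abelian ideal `a` with abelian orthogonal is a plane on which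
`a^⊥` acts by rotations. -/
theorem IsIrreducible.exists_plane (hω : ω.IsIrreducible) {a : LieIdeal ℝ 𝔤}
    (ha : ∀ x ∈ a, ∀ y ∈ a, ⁅x, y⁆ = 0) (hh : ∀ x ∈ ω.orth a, ∀ y ∈ ω.orth a, ⁅x, y⁆ = 0)
    {W : LieIdeal ℝ 𝔤} (hW : IsAtom W) (hWa : W ≤ a) :
    ∃ u ∈ W, ∃ v ∈ W, ω.form u v = 1 ∧ (∀ w ∈ W, ∃ p q : ℝ, w = p • u + q • v) ∧
      ∀ x ∈ ω.orth a, ∃ l : ℝ, ⁅u, x⁆ = l • v ∧ ⁅v, x⁆ = -l • u := by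
  have hWW : ∀ x ∈ W, ∀ y ∈ W, ⁅x, y⁆ = 0 := fun x hx y hy => ha x (hWa hx) y (hWa hy)
  have hnt : Nontrivial W := (LieSubmodule.nontrivial_iff_ne_bot ℝ 𝔤 𝔤).2 hW.1
  obtain ⟨m', hm'0⟩ := exists_ne (0 : W)
  obtain ⟨m, hm⟩ := m'
  have hm0 : m ≠ 0 := fun h => hm'0 (Subtype.ext h)
  have hlie : ∀ x, ∀ u ∈ W, ⁅x, u⁆ ∈ W := fun x u hu => lie_mem_right ℝ 𝔤 W x u hu
  have hcommW : ∀ x ∈ ω.orth a, ∀ (y : 𝔤), ∀ w ∈ W, ⁅x, ⁅y, w⁆⁆ = ⁅y, ⁅x, w⁆⁆ := by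
    intro x hx y w hw
    obtain ⟨b, hb, z, hz, rfl⟩ := hω.exists_add ha y
    rw [add_lie, add_lie, ha b hb _ (hWa hw),
      ha b hb _ (hWa (hlie x w hw)), zero_add, zero_add,
      leibniz_lie x z, hh x hx z hz]
    rw [zero_lie, zero_add]
  have hschur : ∀ x ∈ ω.orth a, (∀ w ∈ W, ⁅x, w⁆ = 0) ∨ (∀ w ∈ W, ⁅x, w⁆ = 0 → w = 0) := by
    intro x hx
    rcases LieIdeal.eq_zero_or_injective_of_isAtom hW (LieModule.toEnd ℝ 𝔤 W x)
      (fun y w => Subtype.ext (hcommW x hx y w w.2)) with h | h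
    · left
      intro w hw
      exact congrArg (fun F : Module.End ℝ W => ((F ⟨w, hw⟩ : W) : 𝔤)) h
    · right
      intro w hw hw0
      have : (⟨w, hw⟩ : W) = 0 := h (by
        rw [map_zero]
        exact Subtype.ext hw0)
      exact congrArg Subtype.val this
  obtain ⟨x₁, hx₁, hJ⟩ : ∃ x ∈ ω.orth a, ∀ w ∈ W, ⁅x, ⁅x, w⁆⁆ = -w := by
    obtain ⟨x, hx, hxm⟩ : ∃ x ∈ ω.orth a, ⁅x, m⁆ ≠ 0 := by
      by_contra hcon
      push Not at hcon
      apply hm0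
      apply hω.eq_zero_of_lie_eq_smul
      intro y
      obtain ⟨b, hb, z, hz, rfl⟩ := hω.exists_add ha y
      exact ⟨0, by rw [add_lie, ha b hb m (hWa hm), hcon z hz, zero_smul, add_zero]⟩
    obtain ⟨q, hq0, hq⟩ := hω.exists_sq_eq ha hh hW hWa hx
    have hinj := (hschur x hx).resolve_left fun h => hxm (h m hm)
    have hqpos : 0 < q := by
      refine lt_of_le_of_ne hq0 ?_
      rintro rfl
      apply hm0
      apply hinj m hm
      apply hinj _ (hlie x m hm)
      rw [hq m hm, neg_zero, zero_smul]
    refine ⟨(√q)⁻¹ • x, (ω.orth a).smul_mem _ hx, fun w hw => ?_⟩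
    have hs : √q ≠ 0 := (Real.sqrt_pos.2 hqpos).ne'
    have hs2 : (√q)⁻¹ * (√q)⁻¹ * q = 1 := by
      have := Real.mul_self_sqrt hq0
      field_simp
      rw [sq, this]
    rw [smul_lie, smul_lie, lie_smul, hq w hw, smul_smul, smul_smul, mul_neg, hs2, neg_one_smul]
  have hact : ∀ y ∈ ω.orth a, ∃ s : ℝ, ∀ w ∈ W, ⁅y, w⁆ = s • ⁅x₁, w⁆ := by
    intro y hy
    obtain ⟨q, hq0, hq⟩ := hω.exists_sq_eq ha hh hW hWa hy
    -- With `J = ad x₁` and `J² = -1` on `W`, the product `(ad y - √q J)(ad y + √q J)` vanishes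
    -- there; by Schur one factor does, so `ad y = ±√q J`.
    have hminus : y - √q • x₁ ∈ ω.orth a := sub_mem hy ((ω.orth a).smul_mem _ hx₁)
    rcases hschur _ hminus with h | h
    · refine ⟨√q, fun w hw => ?_⟩
      have := h w hw
      rwa [sub_lie, smul_lie, sub_eq_zero] at this
    · refine ⟨-√q, fun w hw => ?_⟩
      have h1 : ⁅y, w⁆ + √q • ⁅x₁, w⁆ ∈ W := add_mem (hlie y w hw) (W.smul_mem _ (hlie x₁ w hw))
      have h2 := h _ h1 (by
        rw [sub_lie, lie_add, lie_add, lie_smul, smul_lie, smul_lie, hq w hw, lie_smul, hJ w hw,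
          hcommW x₁ hx₁ y w hw, smul_neg, smul_neg, smul_smul, Real.mul_self_sqrt hq0]
        module)
      rw [neg_smul, ← sub_eq_zero, sub_neg_eq_add, h2]
  set J := ⁅x₁, m⁆ with hJm
  have hJW : J ∈ W := hlie x₁ m hm
  have hJJ : ⁅x₁, J⁆ = -m := hJ m hm
  obtain ⟨I, hI⟩ := hω.exists_ideal ha (W := Submodule.span ℝ {m, J}) (by
    rw [Submodule.span_le]
    rintro y (rfl | rfl)
    · exact hWa hm
    · exact hWa hJW) (by
    intro y hy w hw
    obtain ⟨s, hs⟩ := hact y hy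
    obtain ⟨p, q, rfl⟩ := Submodule.mem_span_pair.1 hw
    rw [lie_add, lie_smul, lie_smul, hs m hm, hs J hJW, hJJ, ← hJm]
    exact Submodule.mem_span_pair.2 ⟨-(q * s), p * s, by module⟩)
  have hmemI : ∀ w, w ∈ I ↔ ∃ p q : ℝ, p • m + q • J = w := by
    intro w
    rw [← LieSubmodule.mem_toSubmodule, hI, Submodule.mem_span_pair]
  have hIW : I = W := by
    refine (hW.le_iff.1 ?_).resolve_left ?_
    · intro w hw
      obtain ⟨p, q, rfl⟩ := (hmemI w).1 hw
      exact add_mem (W.smul_mem _ hm) (W.smul_mem _ hJW)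
    · intro h
      have : m ∈ I := (hmemI m).2 ⟨1, 0, by simp⟩
      rw [h, LieSubmodule.mem_bot] at this
      exact hm0 this
  have hspan : ∀ w ∈ W, ∃ p q : ℝ, p • m + q • J = w := fun w hw => (hmemI w).1 (hIW ▸ hw)
  have hs0 : ω.form m J ≠ 0 := by
    intro h
    apply hm0
    apply hω.eq_zero_of_mem_orth hWW hm
    intro w hw
    obtain ⟨p, q, rfl⟩ := hspan w hw
    simp [ω.alt m, h]
  set s := ω.form m J with hs
  -- Scaling both vectors by `1/r` makes `|ω| = 1`; the sign `ε` is absorbed in the second vector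
  -- and then in the rotation speed.
  obtain ⟨ε, r, hε, hr, hsr⟩ : ∃ ε r : ℝ, ε * ε = 1 ∧ r ≠ 0 ∧ s = ε * r ^ 2 := by
    rcases lt_or_gt_of_ne hs0 with h | h
    · exact ⟨-1, √(-s), by norm_num, (Real.sqrt_pos.2 (by linarith)).ne', by
        rw [Real.sq_sqrt (by linarith)]; ring⟩
    · exact ⟨1, √s, by norm_num, (Real.sqrt_pos.2 h).ne', by rw [Real.sq_sqrt h.le]; ring⟩
  have hε0 : ε ≠ 0 := left_ne_zero_of_mul_eq_one hε
  refine ⟨r⁻¹ • m, W.smul_mem _ hm, (ε * r⁻¹) • J, W.smul_mem _ hJW, ?_, ?_, ?_⟩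
  · simp only [map_smul, LinearMap.smul_apply, smul_eq_mul]
    rw [← hs, hsr]
    field_simp
    linarith
  · intro w hw
    obtain ⟨p, q, rfl⟩ := hspan w hw
    refine ⟨p * r, q * r * ε, ?_⟩
    rw [smul_smul, smul_smul]
    congr 2
    · field_simp
    · field_simp
      linear_combination -q * hε
  · intro y hy
    obtain ⟨t, ht⟩ := hact y hy
    refine ⟨-(ε * t), ?_, ?_⟩
    · rw [← lie_skew, lie_smul, ht m hm, ← hJm, smul_smul, smul_smul, ← neg_smul]
      congr 1
      linear_combination t * r⁻¹ * hε
    · rw [← lie_skew, lie_smul, ht J hJW, hJJ]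
      module

end SymplecticForm

/-! ### The six-dimensional irreducible model -/

namespace SymplecticForm

variable {𝔤 : Type*} [LieRing 𝔤] [LieAlgebra ℝ 𝔤]

/-- The brackets and the symplectic form of `𝔤_(1,0,0,1)` in its standard basis. -/
structure IsFrame (ω : SymplecticForm 𝔤) (η : ℝ) (e₁ e₂ e₃ e₄ e₅ e₆ : 𝔤) : Prop where
  lie12 : ⁅e₁, e₂⁆ = 0
  lie13 : ⁅e₁, e₃⁆ = 0
  lie14 : ⁅e₁, e₄⁆ = 0
  lie15 : ⁅e₁, e₅⁆ = e₂
  lie16 : ⁅e₁, e₆⁆ = 0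
  lie23 : ⁅e₂, e₃⁆ = 0
  lie24 : ⁅e₂, e₄⁆ = 0
  lie25 : ⁅e₂, e₅⁆ = -e₁
  lie26 : ⁅e₂, e₆⁆ = 0
  lie34 : ⁅e₃, e₄⁆ = 0
  lie35 : ⁅e₃, e₅⁆ = 0
  lie36 : ⁅e₃, e₆⁆ = e₄
  lie45 : ⁅e₄, e₅⁆ = 0
  lie46 : ⁅e₄, e₆⁆ = -e₃
  lie56 : ⁅e₅, e₆⁆ = 0
  form12 : ω.form e₁ e₂ = 1
  form13 : ω.form e₁ e₃ = 0
  form14 : ω.form e₁ e₄ = 0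
  form15 : ω.form e₁ e₅ = 0
  form16 : ω.form e₁ e₆ = 0
  form23 : ω.form e₂ e₃ = 0
  form24 : ω.form e₂ e₄ = 0
  form25 : ω.form e₂ e₅ = 0
  form26 : ω.form e₂ e₆ = 0
  form34 : ω.form e₃ e₄ = 1
  form35 : ω.form e₃ e₅ = 0
  form36 : ω.form e₃ e₆ = 0
  form45 : ω.form e₄ e₅ = 0
  form46 : ω.form e₄ e₆ = 0
  form56 : ω.form e₅ e₆ = η

/-- Interchanging the two planes and their rotations reverses `ω(e₅, e₆)`; this is how `η > 0` is
arranged. -/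
theorem IsFrame.swap {ω : SymplecticForm 𝔤} {η : ℝ} {e₁ e₂ e₃ e₄ e₅ e₆ : 𝔤}
    (h : ω.IsFrame η e₁ e₂ e₃ e₄ e₅ e₆) : ω.IsFrame (-η) e₃ e₄ e₁ e₂ e₆ e₅ where
  lie12 := h.lie34
  lie13 := by rw [← lie_skew, h.lie13, neg_zero]
  lie14 := by rw [← lie_skew, h.lie23, neg_zero]
  lie15 := h.lie36
  lie16 := h.lie35
  lie23 := by rw [← lie_skew, h.lie14, neg_zero]
  lie24 := by rw [← lie_skew, h.lie24, neg_zero]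
  lie25 := h.lie46
  lie26 := h.lie45
  lie34 := h.lie12
  lie35 := h.lie16
  lie36 := h.lie15
  lie45 := h.lie26
  lie46 := h.lie25
  lie56 := by rw [← lie_skew, h.lie56, neg_zero]
  form12 := h.form34
  form13 := by rw [form_swap, h.form13, neg_zero]
  form14 := by rw [form_swap, h.form23, neg_zero]
  form15 := h.form36
  form16 := h.form35
  form23 := by rw [form_swap, h.form14, neg_zero]
  form24 := by rw [form_swap, h.form24, neg_zero]
  form25 := h.form46
  form26 := h.form45
  form34 := h.form12
  form35 := h.form16
  form36 := h.form15
  form45 := h.form26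
  form46 := h.form25
  form56 := by rw [form_swap, h.form56]

theorem IsFrame.linearIndependent {ω : SymplecticForm 𝔤} {η : ℝ} {e₁ e₂ e₃ e₄ e₅ e₆ : 𝔤}
    (h : ω.IsFrame η e₁ e₂ e₃ e₄ e₅ e₆) (hη : η ≠ 0) :
    LinearIndependent ℝ ![e₁, e₂, e₃, e₄, e₅, e₆] := by
  rw [Fintype.linearIndependent_iff]
  intro c hc
  have key : ∀ v, ∑ i, c i * ω.form (![e₁, e₂, e₃, e₄, e₅, e₆] i) v = 0 := by
    intro v
    have := congrArg (fun x => ω.form x v) hc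
    simpa [map_sum, LinearMap.sum_apply] using this
  have k1 := key e₁
  have k2 := key e₂
  have k3 := key e₃
  have k4 := key e₄
  have k5 := key e₅
  have k6 := key e₆
  have s := ω.form_swap
  have t : ∀ x, ω.form x x = 0 := ω.alt
  simp [Fin.sum_univ_succ, t, s e₂ e₁, s e₃ e₁, s e₄ e₁, s e₅ e₁, s e₆ e₁, s e₃ e₂, s e₄ e₂,
    s e₅ e₂, s e₆ e₂, s e₄ e₃, s e₅ e₃, s e₆ e₃, s e₅ e₄, s e₆ e₄, s e₆ e₅, h.form12, h.form13,
    h.form14, h.form15, h.form16, h.form23, h.form24, h.form25, h.form26, h.form34, h.form35,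
    h.form36, h.form45, h.form46, h.form56, hη] at k1 k2 k3 k4 k5 k6
  intro i
  fin_cases i
  exacts [k2, k1, k4, k3, k6, k5]

variable [FiniteDimensional ℝ 𝔤]

/-- A nontrivial irreducible symplectic Lie algebra of dimension at most six is
isomorphic to `𝔤_(1,0,0,1)`. -/
theorem IsIrreducible.exists_isFrame [Nontrivial 𝔤] {ω : SymplecticForm 𝔤}
    (hω : ω.IsIrreducible) (hdim : Module.finrank ℝ 𝔤 ≤ 6) :
    ∃ (η : ℝ) (e₁ e₂ e₃ e₄ e₅ e₆ : 𝔤), 0 < η ∧ ω.IsFrame η e₁ e₂ e₃ e₄ e₅ e₆ := by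
  obtain ⟨a, ha, hf⟩ := hω.exists_faithful
  have h2 := hω.finrank_orth_eq_two hdim ha hf
  have hh := hω.lie_orth_eq_zero ha hf h2
  have hfin := ω.finrank_orth a
  -- On a normalized plane `L u x` is the speed `l` in `[u,x] = l v`; writing it through `ω` makes
  -- it linear in `x`.
  let L : 𝔤 → (ω.orth a →ₗ[ℝ] ℝ) := fun u =>
    (ω.form u) ∘ₗ (ad ℝ 𝔤 u) ∘ₗ (ω.orth a).toSubmodule.subtype
  have hL : ∀ u x, L u x = ω.form u ⁅u, (x : 𝔤)⁆ := fun u x => rfl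
  have hplane : ∀ u v : 𝔤, ω.form u v = 1 →
      (∀ x ∈ ω.orth a, ∃ l : ℝ, ⁅u, x⁆ = l • v ∧ ⁅v, x⁆ = -l • u) →
      ∀ x : ω.orth a, ⁅u, (x : 𝔤)⁆ = L u x • v ∧ ⁅v, (x : 𝔤)⁆ = -L u x • u := by
    intro u v huv h x
    obtain ⟨l, h1, h3⟩ := h x x.2
    have : L u x = l := by rw [hL, h1, map_smul, huv, smul_eq_mul, mul_one]
    rw [this]
    exact ⟨h1, h3⟩
  have ha0 : a ≠ ⊥ := by
    rintro rfl
    obtain ⟨x, hx⟩ := exists_ne (0 : 𝔤)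
    apply hx
    refine hf x (fun y hy => ?_) fun y hy => ?_
    · rw [(LieSubmodule.mem_bot y).1 hy, map_zero]
    · rw [(LieSubmodule.mem_bot y).1 hy, lie_zero]
  obtain ⟨W, hW, hWa⟩ := (IsAtomic.eq_bot_or_exists_atom_le a).resolve_left ha0
  have hWW : ∀ x ∈ W, ∀ y ∈ W, ⁅x, y⁆ = 0 := fun x hx y hy => ha x (hWa hx) y (hWa hy)
  obtain ⟨e₁, he₁, e₂, he₂, f12, hspan, hact⟩ := hω.exists_plane ha hh hW hWa
  have hact := hplane e₁ e₂ f12 hact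
  obtain ⟨U, hU⟩ := hω.exists_ideal ha
    (W := a.toSubmodule ⊓ (ω.orth W).toSubmodule) inf_le_left (by
      rintro x hx b ⟨hb, hb'⟩
      refine ⟨lie_mem_right ℝ 𝔤 a x b hb, fun y hy => ?_⟩
      rw [ω.form_lie_of_abelian ha x hb (hWa hy), hb' _ (lie_mem_right ℝ 𝔤 W x y hy), neg_zero])
  have hUmem : ∀ b, b ∈ U ↔ b ∈ a ∧ b ∈ ω.orth W := by
    intro b
    rw [← LieSubmodule.mem_toSubmodule, hU]
    rfl
  -- If `a` were the single plane `W`, the one speed functional on the two-dimensional `a^⊥` would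
  -- have a kernel, contradicting faithfulness.
  have hU0 : U ≠ ⊥ := by
    intro hU0
    have hker : 0 < Module.finrank ℝ (LinearMap.ker (L e₁)) := by
      have h3 := (L e₁).finrank_range_add_finrank_ker
      have h4 := (LinearMap.range (L e₁)).finrank_le
      rw [Module.finrank_self] at h4
      omega
    obtain ⟨⟨x, hxk⟩, hx⟩ := (Module.finrank_pos_iff_exists_ne_zero).1 hker
    apply hx
    have hxk' : L e₁ x = 0 := hxk
    apply Subtype.ext
    apply Subtype.ext
    apply hf x x.2
    intro y hy
    obtain ⟨w, hw, m, hm, rfl⟩ := hω.exists_add hWW y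
    have hmU : m ∈ U := (hUmem m).2 ⟨by simpa using sub_mem hy (hWa hw), hm⟩
    rw [hU0, LieSubmodule.mem_bot] at hmU
    obtain ⟨p, q, rfl⟩ := hspan w hw
    rw [hmU, add_zero, ← lie_skew, add_lie, smul_lie, smul_lie, (hact x).1, (hact x).2, hxk']
    simp
  obtain ⟨W', hW', hWU'⟩ := (IsAtomic.eq_bot_or_exists_atom_le U).resolve_left hU0
  have hWa' : W' ≤ a := fun x hx => ((hUmem x).1 (hWU' hx)).1
  obtain ⟨e₃, he₃, e₄, he₄, f34, -, hact'⟩ := hω.exists_plane ha hh hW' hWa'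
  have hact' := hplane e₃ e₄ f34 hact'
  have hcross : ∀ x ∈ W, ∀ y ∈ W', ω.form x y = 0 := by
    intro x hx y hy
    rw [ω.form_swap, ((hUmem y).1 (hWU' hy)).2 x hx, neg_zero]
  have f13 := hcross e₁ he₁ e₃ he₃
  have f14 := hcross e₁ he₁ e₄ he₄
  have f23 := hcross e₂ he₂ e₃ he₃
  have f24 := hcross e₂ he₂ e₄ he₄
  have hli : LinearIndependent ℝ ![(⟨e₁, hWa he₁⟩ : a), ⟨e₂, hWa he₂⟩, ⟨e₃, hWa' he₃⟩,
      ⟨e₄, hWa' he₄⟩] := by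
    rw [Fintype.linearIndependent_iff]
    intro c hc
    have hc' : c 0 • e₁ + c 1 • e₂ + c 2 • e₃ + c 3 • e₄ = 0 := by
      rw [Fin.sum_univ_four] at hc
      exact congrArg Subtype.val hc
    have key : ∀ v, c 0 * ω.form e₁ v + c 1 * ω.form e₂ v + c 2 * ω.form e₃ v
        + c 3 * ω.form e₄ v = 0 := by
      intro v
      have := congrArg (fun x => ω.form x v) hc'
      simpa using this
    have k1 := key e₁
    have k2 := key e₂
    have k3 := key e₃
    have k4 := key e₄
    have s := ω.form_swap
    have t : ∀ x, ω.form x x = 0 := ω.alt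
    simp [t, s e₂ e₁, s e₃ e₁, s e₄ e₁, s e₃ e₂, s e₄ e₂, s e₄ e₃, f12, f13, f14, f23, f24,
      f34] at k1 k2 k3 k4
    intro i
    fin_cases i
    exacts [k2, k1, k4, k3]
  have hcard := hli.fintype_card_le_finrank
  rw [Fintype.card_fin] at hcard
  have h4 : Module.finrank ℝ a = 4 := by omega
  have hspana : ∀ y ∈ a, ∃ p q r s : ℝ, y = p • e₁ + q • e₂ + r • e₃ + s • e₄ := by
    intro y hy
    let b := basisOfLinearIndependentOfCardEqFinrank hli (by simp [h4])
    have h := b.sum_repr ⟨y, hy⟩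
    rw [Fin.sum_univ_four] at h
    simp only [b, coe_basisOfLinearIndependentOfCardEqFinrank] at h
    exact ⟨_, _, _, _, (congrArg Subtype.val h).symm⟩
  -- The two speeds are coordinates on `a^⊥`, by faithfulness and dimension; `e₅` and `e₆` are the
  -- corresponding basis.
  let Λ : ω.orth a →ₗ[ℝ] ℝ × ℝ := (L e₁).prod (L e₃)
  have hΛinj : Function.Injective Λ := by
    rw [← LinearMap.ker_eq_bot, LinearMap.ker_eq_bot']
    intro x hx
    have h1 : L e₁ x = 0 := congrArg Prod.fst hx
    have h3 : L e₃ x = 0 := congrArg Prod.snd hx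
    apply Subtype.ext
    apply hf x x.2
    intro y hy
    obtain ⟨p, q, r, s, rfl⟩ := hspana y hy
    rw [← lie_skew, add_lie, add_lie, add_lie, smul_lie, smul_lie, smul_lie, smul_lie,
      (hact x).1, (hact x).2, (hact' x).1, (hact' x).2, h1, h3]
    simp
  have hΛsurj : Function.Surjective Λ :=
    (LinearMap.injective_iff_surjective_of_finrank_eq_finrank (by simp [h2])).1 hΛinj
  obtain ⟨e₅, he₅⟩ := hΛsurj (1, 0)
  obtain ⟨e₆, he₆⟩ := hΛsurj (0, 1)
  have l15 : L e₁ e₅ = 1 := congrArg Prod.fst he₅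
  have l35 : L e₃ e₅ = 0 := congrArg Prod.snd he₅
  have l16 : L e₁ e₆ = 0 := congrArg Prod.fst he₆
  have l36 : L e₃ e₆ = 1 := congrArg Prod.snd he₆
  have hspanh : ∀ x : ω.orth a, x = L e₁ x • e₅ + L e₃ x • e₆ := by
    intro x
    apply hΛinj
    rw [map_add, map_smul, map_smul, he₅, he₆]
    ext <;> simp [Λ]
  have forth : ∀ x : ω.orth a, ∀ y ∈ a, ω.form y x = 0 := fun x y hy => by
    rw [ω.form_swap, x.2 y hy, neg_zero]
  have hframe : ω.IsFrame (ω.form e₅ e₆) e₁ e₂ e₃ e₄ e₅ e₆ :=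
    { lie12 := hWW e₁ he₁ e₂ he₂
      lie13 := ha e₁ (hWa he₁) e₃ (hWa' he₃)
      lie14 := ha e₁ (hWa he₁) e₄ (hWa' he₄)
      lie15 := by rw [(hact e₅).1, l15, one_smul]
      lie16 := by rw [(hact e₆).1, l16, zero_smul]
      lie23 := ha e₂ (hWa he₂) e₃ (hWa' he₃)
      lie24 := ha e₂ (hWa he₂) e₄ (hWa' he₄)
      lie25 := by rw [(hact e₅).2, l15, neg_one_smul]
      lie26 := by rw [(hact e₆).2, l16, neg_zero, zero_smul]
      lie34 := ha e₃ (hWa' he₃) e₄ (hWa' he₄)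
      lie35 := by rw [(hact' e₅).1, l35, zero_smul]
      lie36 := by rw [(hact' e₆).1, l36, one_smul]
      lie45 := by rw [(hact' e₅).2, l35, neg_zero, zero_smul]
      lie46 := by rw [(hact' e₆).2, l36, neg_one_smul]
      lie56 := hh e₅ e₅.2 e₆ e₆.2
      form12 := f12
      form13 := f13
      form14 := f14
      form15 := forth e₅ e₁ (hWa he₁)
      form16 := forth e₆ e₁ (hWa he₁)
      form23 := f23
      form24 := f24
      form25 := forth e₅ e₂ (hWa he₂)
      form26 := forth e₆ e₂ (hWa he₂)
      form34 := f34
      form35 := forth e₅ e₃ (hWa' he₃)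
      form36 := forth e₆ e₃ (hWa' he₃)
      form45 := forth e₅ e₄ (hWa' he₄)
      form46 := forth e₆ e₄ (hWa' he₄)
      form56 := rfl }
  have hη : ω.form e₅ e₆ ≠ 0 := by
    intro h0
    have he0 : (e₅ : 𝔤) = 0 := by
      apply ω.eq_zero_of_form_eq_zero
      intro v
      obtain ⟨b, hb, x, hx, rfl⟩ := hω.exists_add ha v
      have hx' : x = L e₁ ⟨x, hx⟩ • (e₅ : 𝔤) + L e₃ ⟨x, hx⟩ • (e₆ : 𝔤) :=
        congrArg Subtype.val (hspanh ⟨x, hx⟩)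
      rw [map_add, e₅.2 b hb, zero_add, hx', map_add, map_smul, map_smul, h0, ω.alt]
      simp
    have : e₅ = 0 := Subtype.ext he0
    rw [this, map_zero] at l15
    exact zero_ne_one l15
  rcases lt_or_gt_of_ne hη with h | h
  · exact ⟨_, _, _, _, _, _, _, neg_pos.2 h, hframe.swap⟩
  · exact ⟨_, _, _, _, _, _, _, h, hframe⟩

/-! ### Reductions in dimension at most six -/

theorem finrank_reduction (ω : SymplecticForm 𝔤) (j : LieIdeal ℝ 𝔤) (hj : ω.IsIsotropic j) :
    Module.finrank ℝ (ω.Reduction j) + 2 * Module.finrank ℝ j = Module.finrank ℝ 𝔤 := by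
  have h1 := ω.finrank_orth j
  have h2 := Submodule.finrank_quotient_add_finrank (j.comap (ω.orth j).incl).toSubmodule
  have h3 : Module.finrank ℝ (j.comap (ω.orth j).incl).toSubmodule = Module.finrank ℝ j := by
    refine LinearEquiv.finrank_eq (LinearEquiv.ofBijective
      (((ω.orth j).toSubmodule.subtype ∘ₗ
        (j.comap (ω.orth j).incl).toSubmodule.subtype).codRestrict j.toSubmodule
          fun x => (ω.mem_comap_incl j x.1).1 x.2) ⟨?_, ?_⟩)
    · intro x y hxy
      have h : ((x : ω.orth j) : 𝔤) = ((y : ω.orth j) : 𝔤) :=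
        congrArg (Subtype.val : j.toSubmodule → 𝔤) hxy
      exact Subtype.ext (Subtype.ext h)
    · rintro ⟨y, hy⟩
      exact ⟨⟨⟨y, hj y hy⟩, (ω.mem_comap_incl j _).2 hy⟩, rfl⟩
  change Module.finrank ℝ (ω.Reduction j) + _ = Module.finrank ℝ (ω.orth j) at h2
  omega

/-- A symplectic Lie algebra of dimension at most six which is not completely reducible is
six-dimensional and irreducible. -/
theorem irreducible_of_not_isCompletelyReducible (n : ℕ) : ∀ {𝔤 : Type*} [LieRing 𝔤]
    [LieAlgebra ℝ 𝔤] [FiniteDimensional ℝ 𝔤] (ω : SymplecticForm 𝔤),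
    Module.finrank ℝ 𝔤 = n → n ≤ 6 → ¬ ω.IsCompletelyReducible →
    n = 6 ∧ ω.IsIrreducible ∧ Nontrivial 𝔤 := by
  induction n using Nat.strong_induction_on with
  | _ n ih =>
    intro 𝔤 _ _ _ ω hn hn6 hω
    have hnt : Nontrivial 𝔤 := by
      by_contra h
      rw [not_nontrivial_iff_subsingleton] at h
      exact hω (IsCompletelyReducible.trivial ω)
    -- A nonzero isotropic ideal would give a reduction of smaller dimension that is still not
    -- completely reducible; by induction that dimension is six, which is impossible below `n ≤ 6`.
    have hirr : ω.IsIrreducible := by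
      intro j hj
      by_contra hj0
      have h1 := ω.finrank_reduction j hj
      have h2 : Module.finrank ℝ j ≠ 0 := by
        intro h
        apply hj0
        have : j.toSubmodule = ⊥ := Submodule.finrank_eq_zero.1 h
        exact (LieSubmodule.toSubmodule_eq_bot j).1 this
      have h3 := ih (Module.finrank ℝ (ω.Reduction j)) (by omega) (ω.reduce j hj) rfl (by omega)
        fun h => hω (IsCompletelyReducible.step ω j hj h)
      omega
    refine ⟨?_, hirr, hnt⟩
    obtain ⟨η, e₁, e₂, e₃, e₄, e₅, e₆, hη, h⟩ := hirr.exists_isFrame (hn.le.trans hn6)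
    have := (h.linearIndependent hη.ne').fintype_card_le_finrank
    rw [Fintype.card_fin] at this
    omega

end SymplecticForm

/-! ### Standard frames of the eight-dimensional algebras -/

namespace SymplecticForm

variable {𝔤 : Type*} [LieRing 𝔤] [LieAlgebra ℝ 𝔤]

/-- The brackets and the symplectic form of a normal oxidation of `𝔤_(1,0,0,1)` in its standard
basis. -/
structure IsNormalFrame (ω : SymplecticForm 𝔤) (a b p q η α β c : ℝ)
    (e₁ e₂ e₃ e₄ e₅ e₆ e₇ e₈ : 𝔤) : Prop where
  lie12 : ⁅e₁, e₂⁆ = p • e₇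
  lie13 : ⁅e₁, e₃⁆ = 0
  lie14 : ⁅e₁, e₄⁆ = 0
  lie15 : ⁅e₁, e₅⁆ = e₂
  lie16 : ⁅e₁, e₆⁆ = 0
  lie17 : ⁅e₁, e₇⁆ = 0
  lie81 : ⁅e₈, e₁⁆ = a • e₁
  lie23 : ⁅e₂, e₃⁆ = 0
  lie24 : ⁅e₂, e₄⁆ = 0
  lie25 : ⁅e₂, e₅⁆ = -e₁
  lie26 : ⁅e₂, e₆⁆ = 0
  lie27 : ⁅e₂, e₇⁆ = 0
  lie82 : ⁅e₈, e₂⁆ = a • e₂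
  lie34 : ⁅e₃, e₄⁆ = q • e₇
  lie35 : ⁅e₃, e₅⁆ = 0
  lie36 : ⁅e₃, e₆⁆ = e₄
  lie37 : ⁅e₃, e₇⁆ = 0
  lie83 : ⁅e₈, e₃⁆ = b • e₃
  lie45 : ⁅e₄, e₅⁆ = 0
  lie46 : ⁅e₄, e₆⁆ = -e₃
  lie47 : ⁅e₄, e₇⁆ = 0
  lie84 : ⁅e₈, e₄⁆ = b • e₄
  lie56 : ⁅e₅, e₆⁆ = 0
  lie57 : ⁅e₅, e₇⁆ = 0
  lie85 : ⁅e₈, e₅⁆ = 0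
  lie67 : ⁅e₆, e₇⁆ = 0
  lie86 : ⁅e₈, e₆⁆ = 0
  lie87 : ⁅e₈, e₇⁆ = e₇
  form12 : ω.form e₁ e₂ = 1
  form13 : ω.form e₁ e₃ = 0
  form14 : ω.form e₁ e₄ = 0
  form15 : ω.form e₁ e₅ = 0
  form16 : ω.form e₁ e₆ = 0
  form17 : ω.form e₁ e₇ = 0
  form18 : ω.form e₁ e₈ = 0
  form23 : ω.form e₂ e₃ = 0
  form24 : ω.form e₂ e₄ = 0
  form25 : ω.form e₂ e₅ = 0
  form26 : ω.form e₂ e₆ = 0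
  form27 : ω.form e₂ e₇ = 0
  form28 : ω.form e₂ e₈ = 0
  form34 : ω.form e₃ e₄ = 1
  form35 : ω.form e₃ e₅ = 0
  form36 : ω.form e₃ e₆ = 0
  form37 : ω.form e₃ e₇ = 0
  form38 : ω.form e₃ e₈ = 0
  form45 : ω.form e₄ e₅ = 0
  form46 : ω.form e₄ e₆ = 0
  form47 : ω.form e₄ e₇ = 0
  form48 : ω.form e₄ e₈ = 0
  form56 : ω.form e₅ e₆ = η
  form57 : ω.form e₅ e₇ = 0
  form58 : ω.form e₅ e₈ = α
  form67 : ω.form e₆ e₇ = 0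
  form68 : ω.form e₆ e₈ = β
  form78 : ω.form e₇ e₈ = c

variable [FiniteDimensional ℝ 𝔤]

/-- A standard frame of an eight-dimensional symplectic Lie algebra identifies it with a normal
oxidation of `𝔤_(1,0,0,1)`. -/
theorem IsNormalFrame.symplectomorphic {ω : SymplecticForm 𝔤} (d : NormalData)
    {η α β c : ℝ} {e₁ e₂ e₃ e₄ e₅ e₆ e₇ e₈ : 𝔤}
    (h : ω.IsNormalFrame d.a d.b d.p d.q η α β c e₁ e₂ e₃ e₄ e₅ e₆ e₇ e₈)
    (hdim : Module.finrank ℝ 𝔤 = 8) (hη : η ≠ 0) (hc : c ≠ 0)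
    (hp : c * d.p + 2 * d.a = 0) (hq : c * d.q + 2 * d.b = 0) :
    Symplectomorphic ω (d.symplecticForm η α β c hη hc hp hq) := by
  let Φ : d.Algebra →ₗ[ℝ] 𝔤 :=
    (Fintype.linearCombination ℝ ![e₁, e₂, e₃, e₄, e₅, e₆, e₇, e₈]) ∘ₗ d.coord.toLinearMap
  have hΦ : ∀ v, Φ v = d.coord v 0 • e₁ + d.coord v 1 • e₂ + d.coord v 2 • e₃ + d.coord v 3 • e₄
      + d.coord v 4 • e₅ + d.coord v 5 • e₆ + d.coord v 6 • e₇ + d.coord v 7 • e₈ := by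
    intro v
    change Fintype.linearCombination ℝ ![e₁, e₂, e₃, e₄, e₅, e₆, e₇, e₈] (d.coord v) = _
    rw [Fintype.linearCombination_apply, Fin.sum_univ_eight]
    rfl
  have hform : ∀ v w, ω.form (Φ v) (Φ w) = (d.symplecticForm η α β c hη hc hp hq).form v w := by
    intro v w
    have s := ω.form_swap
    have t : ∀ x, ω.form x x = 0 := ω.alt
    rw [hΦ, hΦ]
    simp only [map_add, map_smul, LinearMap.add_apply, LinearMap.smul_apply, smul_eq_mul, t,
      s e₂ e₁, s e₃ e₁, s e₄ e₁, s e₅ e₁, s e₆ e₁, s e₇ e₁, s e₈ e₁, s e₃ e₂, s e₄ e₂, s e₅ e₂,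
      s e₆ e₂, s e₇ e₂, s e₈ e₂, s e₄ e₃, s e₅ e₃, s e₆ e₃, s e₇ e₃, s e₈ e₃, s e₅ e₄, s e₆ e₄,
      s e₇ e₄, s e₈ e₄, s e₆ e₅, s e₇ e₅, s e₈ e₅, s e₇ e₆, s e₈ e₆, s e₈ e₇,
      h.form12, h.form13, h.form14, h.form15, h.form16, h.form17, h.form18, h.form23, h.form24,
      h.form25, h.form26, h.form27, h.form28, h.form34, h.form35, h.form36, h.form37, h.form38,
      h.form45, h.form46, h.form47, h.form48, h.form56, h.form57, h.form58, h.form67, h.form68,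
      h.form78]
    change _ = wedge 0 1 (d.coord v) (d.coord w) + wedge 2 3 (d.coord v) (d.coord w)
        + η * wedge 4 5 (d.coord v) (d.coord w) + α * wedge 4 7 (d.coord v) (d.coord w)
        + β * wedge 5 7 (d.coord v) (d.coord w) + c * wedge 6 7 (d.coord v) (d.coord w)
    simp only [wedge]
    ring
  have hlie : ∀ v w, Φ ⁅v, w⁆ = ⁅Φ v, Φ w⁆ := by
    intro v w
    have s : ∀ x y : 𝔤, ⁅x, y⁆ = -⁅y, x⁆ := fun x y => (lie_skew x y).symm
    rw [hΦ, hΦ, hΦ, d.coord_lie]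
    simp only [add_lie, lie_add, smul_lie, lie_smul, lie_self,
      s e₂ e₁, s e₃ e₁, s e₄ e₁, s e₅ e₁, s e₆ e₁, s e₇ e₁, s e₁ e₈, s e₃ e₂, s e₄ e₂, s e₅ e₂,
      s e₆ e₂, s e₇ e₂, s e₂ e₈, s e₄ e₃, s e₅ e₃, s e₆ e₃, s e₇ e₃, s e₃ e₈, s e₅ e₄, s e₆ e₄,
      s e₇ e₄, s e₄ e₈, s e₆ e₅, s e₇ e₅, s e₅ e₈, s e₇ e₆, s e₆ e₈, s e₇ e₈,
      h.lie12, h.lie13, h.lie14, h.lie15, h.lie16, h.lie17, h.lie81, h.lie23, h.lie24, h.lie25,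
      h.lie26, h.lie27, h.lie82, h.lie34, h.lie35, h.lie36, h.lie37, h.lie83, h.lie45, h.lie46,
      h.lie47, h.lie84, h.lie56, h.lie57, h.lie85, h.lie67, h.lie86, h.lie87]
    simp only [NormalData.bracketCoord, wedge, Matrix.cons_val]
    module
  -- A map preserving a nondegenerate form is injective, so independence of the frame needs no
  -- separate check.
  have hinj : Function.Injective Φ := by
    rw [← LinearMap.ker_eq_bot, LinearMap.ker_eq_bot']
    intro v hv
    apply (d.symplecticForm η α β c hη hc hp hq).eq_zero_of_form_eq_zero
    intro w
    rw [← hform, hv, map_zero, LinearMap.zero_apply]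
  have hdim' : Module.finrank ℝ d.Algebra = Module.finrank ℝ 𝔤 := by
    rw [hdim, d.coord.finrank_eq, Module.finrank_fin_fun]
  have hbij : Function.Bijective Φ :=
    ⟨hinj, (LinearMap.injective_iff_surjective_of_finrank_eq_finrank hdim').1 hinj⟩
  let Ψ : d.Algebra ≃ₗ⁅ℝ⁆ 𝔤 :=
    LieEquiv.ofBijective { Φ with map_lie' := fun {v w} => hlie v w } hbij
  have hΨ : ∀ v, Ψ v = Φ v := fun v => rfl
  refine ⟨Ψ.symm, fun x y => ?_⟩
  rw [← hform, ← hΨ, ← hΨ, Ψ.apply_symm_apply, Ψ.apply_symm_apply]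

end SymplecticForm

/-! ### Derivations of the six-dimensional model -/

namespace SymplecticForm

variable {𝔤 : Type*} [LieRing 𝔤] [LieAlgebra ℝ 𝔤]

set_option linter.unusedSimpArgs false in
/-- Up to inner derivations, a derivation of `𝔤_(1,0,0,1)` is diagonal. -/
theorem IsFrame.exists_derivation {ω : SymplecticForm 𝔤} {η : ℝ} {e₁ e₂ e₃ e₄ e₅ e₆ : 𝔤}
    (h : ω.IsFrame η e₁ e₂ e₃ e₄ e₅ e₆) (hη : η ≠ 0) (hdim : Module.finrank ℝ 𝔤 = 6)
    (D : 𝔤 →ₗ[ℝ] 𝔤) (hD : ∀ x y, D ⁅x, y⁆ = ⁅D x, y⁆ + ⁅x, D y⁆) :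
    ∃ (w : 𝔤) (a b : ℝ), D e₁ - ⁅w, e₁⁆ = a • e₁ ∧ D e₂ - ⁅w, e₂⁆ = a • e₂ ∧
      D e₃ - ⁅w, e₃⁆ = b • e₃ ∧ D e₄ - ⁅w, e₄⁆ = b • e₄ ∧ D e₅ - ⁅w, e₅⁆ = 0 ∧
      D e₆ - ⁅w, e₆⁆ = 0 := by
  have hli := h.linearIndependent hη
  have lin : ∀ c₁ c₂ c₃ c₄ c₅ c₆ : ℝ,
      c₁ • e₁ + c₂ • e₂ + c₃ • e₃ + c₄ • e₄ + c₅ • e₅ + c₆ • e₆ = 0 →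
      c₁ = 0 ∧ c₂ = 0 ∧ c₃ = 0 ∧ c₄ = 0 ∧ c₅ = 0 ∧ c₆ = 0 := by
    intro c₁ c₂ c₃ c₄ c₅ c₆ hc
    have := Fintype.linearIndependent_iff.1 hli ![c₁, c₂, c₃, c₄, c₅, c₆]
      (by rw [Fin.sum_univ_six]; exact hc)
    exact ⟨this 0, this 1, this 2, this 3, this 4, this 5⟩
  have hspan : ∀ v : 𝔤, ∃ c₁ c₂ c₃ c₄ c₅ c₆ : ℝ,
      v = c₁ • e₁ + c₂ • e₂ + c₃ • e₃ + c₄ • e₄ + c₅ • e₅ + c₆ • e₆ := by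
    intro v
    let b := basisOfLinearIndependentOfCardEqFinrank hli (by simp [hdim])
    have h := b.sum_repr v
    rw [Fin.sum_univ_six] at h
    simp only [b, coe_basisOfLinearIndependentOfCardEqFinrank] at h
    exact ⟨_, _, _, _, _, _, h.symm⟩
  obtain ⟨a₁, a₂, a₃, a₄, a₅, a₆, ha⟩ := hspan (D e₁)
  obtain ⟨b₁, b₂, b₃, b₄, b₅, b₆, hb⟩ := hspan (D e₂)
  obtain ⟨c₁, c₂, c₃, c₄, c₅, c₆, hc⟩ := hspan (D e₃)
  obtain ⟨d₁, d₂, d₃, d₄, d₅, d₆, hd⟩ := hspan (D e₄)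
  obtain ⟨p₁, p₂, p₃, p₄, p₅, p₆, hp⟩ := hspan (D e₅)
  obtain ⟨q₁, q₂, q₃, q₄, q₅, q₆, hq⟩ := hspan (D e₆)
  have s : ∀ x y : 𝔤, ⁅x, y⁆ = -⁅y, x⁆ := fun x y => (lie_skew x y).symm
  -- The Leibniz rule on seven pairs suffices. The pairs 15, 25, 36, 46 make `D` preserve each plane
  -- and act there as a scalar plus a rotation; 56, 16, 35 restrict the images of `e₅` and `e₆`.
  have h56 := hD e₅ e₆
  rw [h.lie56, map_zero, hp, hq, ← sub_eq_zero] at h56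
  simp only [add_lie, lie_add, smul_lie, lie_smul, lie_self,
      s e₂ e₁, s e₃ e₁, s e₄ e₁, s e₅ e₁, s e₆ e₁, s e₃ e₂,
      s e₄ e₂, s e₅ e₂, s e₆ e₂, s e₄ e₃, s e₅ e₃, s e₆ e₃,
      s e₅ e₄, s e₆ e₄, s e₆ e₅,
      h.lie12, h.lie13, h.lie14, h.lie15, h.lie16, h.lie23,
      h.lie24, h.lie25, h.lie26, h.lie34, h.lie35, h.lie36,
      h.lie45, h.lie46, h.lie56] at h56
  obtain ⟨u56₁, u56₂, u56₃, u56₄, u56₅, u56₆⟩ := lin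
    (-q₂)
    (q₁)
    (p₄)
    (-p₃)
    (0)
    (0) (by
      rw [← h56]; module)
  have h15 := hD e₁ e₅
  rw [h.lie15, hb, ha, hp, ← sub_eq_zero] at h15
  simp only [add_lie, lie_add, smul_lie, lie_smul, lie_self,
      s e₂ e₁, s e₃ e₁, s e₄ e₁, s e₅ e₁, s e₆ e₁, s e₃ e₂,
      s e₄ e₂, s e₅ e₂, s e₆ e₂, s e₄ e₃, s e₅ e₃, s e₆ e₃,
      s e₅ e₄, s e₆ e₄, s e₆ e₅,
      h.lie12, h.lie13, h.lie14, h.lie15, h.lie16, h.lie23,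
      h.lie24, h.lie25, h.lie26, h.lie34, h.lie35, h.lie36,
      h.lie45, h.lie46, h.lie56] at h15
  obtain ⟨u15₁, u15₂, u15₃, u15₄, u15₅, u15₆⟩ := lin
    (b₁ + a₂)
    (b₂ - a₁ - p₅)
    (b₃)
    (b₄)
    (b₅)
    (b₆) (by
      rw [← h15]; module)
  have h25 := hD e₂ e₅
  rw [h.lie25, map_neg, ha, hb, hp, ← sub_eq_zero] at h25
  simp only [add_lie, lie_add, smul_lie, lie_smul, lie_self,
      s e₂ e₁, s e₃ e₁, s e₄ e₁, s e₅ e₁, s e₆ e₁, s e₃ e₂,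
      s e₄ e₂, s e₅ e₂, s e₆ e₂, s e₄ e₃, s e₅ e₃, s e₆ e₃,
      s e₅ e₄, s e₆ e₄, s e₆ e₅,
      h.lie12, h.lie13, h.lie14, h.lie15, h.lie16, h.lie23,
      h.lie24, h.lie25, h.lie26, h.lie34, h.lie35, h.lie36,
      h.lie45, h.lie46, h.lie56] at h25
  obtain ⟨u25₁, u25₂, u25₃, u25₄, u25₅, u25₆⟩ := lin
    (-a₁ + b₂ + p₅)
    (-a₂ - b₁)
    (-a₃)
    (-a₄)
    (-a₅)
    (-a₆) (by
      rw [← h25]; module)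
  have h36 := hD e₃ e₆
  rw [h.lie36, hd, hc, hq, ← sub_eq_zero] at h36
  simp only [add_lie, lie_add, smul_lie, lie_smul, lie_self,
      s e₂ e₁, s e₃ e₁, s e₄ e₁, s e₅ e₁, s e₆ e₁, s e₃ e₂,
      s e₄ e₂, s e₅ e₂, s e₆ e₂, s e₄ e₃, s e₅ e₃, s e₆ e₃,
      s e₅ e₄, s e₆ e₄, s e₆ e₅,
      h.lie12, h.lie13, h.lie14, h.lie15, h.lie16, h.lie23,
      h.lie24, h.lie25, h.lie26, h.lie34, h.lie35, h.lie36,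
      h.lie45, h.lie46, h.lie56] at h36
  obtain ⟨u36₁, u36₂, u36₃, u36₄, u36₅, u36₆⟩ := lin
    (d₁)
    (d₂)
    (d₃ + c₄)
    (d₄ - c₃ - q₆)
    (d₅)
    (d₆) (by
      rw [← h36]; module)
  have h46 := hD e₄ e₆
  rw [h.lie46, map_neg, hc, hd, hq, ← sub_eq_zero] at h46
  simp only [add_lie, lie_add, smul_lie, lie_smul, lie_self,
      s e₂ e₁, s e₃ e₁, s e₄ e₁, s e₅ e₁, s e₆ e₁, s e₃ e₂,
      s e₄ e₂, s e₅ e₂, s e₆ e₂, s e₄ e₃, s e₅ e₃, s e₆ e₃,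
      s e₅ e₄, s e₆ e₄, s e₆ e₅,
      h.lie12, h.lie13, h.lie14, h.lie15, h.lie16, h.lie23,
      h.lie24, h.lie25, h.lie26, h.lie34, h.lie35, h.lie36,
      h.lie45, h.lie46, h.lie56] at h46
  obtain ⟨u46₁, u46₂, u46₃, u46₄, u46₅, u46₆⟩ := lin
    (-c₁)
    (-c₂)
    (-c₃ + d₄ + q₆)
    (-c₄ - d₃)
    (-c₅)
    (-c₆) (by
      rw [← h46]; module)
  have h16 := hD e₁ e₆
  rw [h.lie16, map_zero, ha, hq, ← sub_eq_zero] at h16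
  simp only [add_lie, lie_add, smul_lie, lie_smul, lie_self,
      s e₂ e₁, s e₃ e₁, s e₄ e₁, s e₅ e₁, s e₆ e₁, s e₃ e₂,
      s e₄ e₂, s e₅ e₂, s e₆ e₂, s e₄ e₃, s e₅ e₃, s e₆ e₃,
      s e₅ e₄, s e₆ e₄, s e₆ e₅,
      h.lie12, h.lie13, h.lie14, h.lie15, h.lie16, h.lie23,
      h.lie24, h.lie25, h.lie26, h.lie34, h.lie35, h.lie36,
      h.lie45, h.lie46, h.lie56] at h16
  obtain ⟨u16₁, u16₂, u16₃, u16₄, u16₅, u16₆⟩ := lin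
    (0)
    (-q₅)
    (a₄)
    (-a₃)
    (0)
    (0) (by
      rw [← h16]; module)
  have h35 := hD e₃ e₅
  rw [h.lie35, map_zero, hc, hp, ← sub_eq_zero] at h35
  simp only [add_lie, lie_add, smul_lie, lie_smul, lie_self,
      s e₂ e₁, s e₃ e₁, s e₄ e₁, s e₅ e₁, s e₆ e₁, s e₃ e₂,
      s e₄ e₂, s e₅ e₂, s e₆ e₂, s e₄ e₃, s e₅ e₃, s e₆ e₃,
      s e₅ e₄, s e₆ e₄, s e₆ e₅,
      h.lie12, h.lie13, h.lie14, h.lie15, h.lie16, h.lie23,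
      h.lie24, h.lie25, h.lie26, h.lie34, h.lie35, h.lie36,
      h.lie45, h.lie46, h.lie56] at h35
  obtain ⟨u35₁, u35₂, u35₃, u35₄, u35₅, u35₆⟩ := lin
    (c₂)
    (-c₁)
    (0)
    (-p₆)
    (0)
    (0) (by
      rw [← h35]; module)
  -- The plane components of `w` reproduce `D e₅` and `D e₆`; its `e₅` and `e₆` components cancel
  -- the rotation parts of `D` on the two planes.
  refine ⟨p₂ • e₁ - p₁ • e₂ + q₄ • e₃ - q₃ • e₄ - a₂ • e₅ - c₄ • e₆, a₁, c₃, ?_, ?_, ?_, ?_, ?_, ?_⟩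
  all_goals
    simp only [ha, hb, hc, hd, hp, hq, sub_lie, add_lie, lie_add, smul_lie, lie_smul, lie_self,
      s e₂ e₁, s e₃ e₁, s e₄ e₁, s e₅ e₁, s e₆ e₁, s e₃ e₂,
      s e₄ e₂, s e₅ e₂, s e₆ e₂, s e₄ e₃, s e₅ e₃, s e₆ e₃,
      s e₅ e₄, s e₆ e₄, s e₆ e₅,
      h.lie12, h.lie13, h.lie14, h.lie15, h.lie16, h.lie23,
      h.lie24, h.lie25, h.lie26, h.lie34, h.lie35, h.lie36,
      h.lie45, h.lie46, h.lie56]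
  · obtain rfl : a₃ = 0 := by linarith
    obtain rfl : a₄ = 0 := by linarith
    obtain rfl : a₅ = 0 := by linarith
    obtain rfl : a₆ = 0 := by linarith
    module
  · obtain rfl : b₁ = -a₂ := by linarith
    obtain rfl : b₂ = a₁ := by linarith
    rw [u15₃, u15₄, u15₅, u15₆]
    module
  · obtain rfl : c₁ = 0 := by linarith
    obtain rfl : c₂ = 0 := by linarith
    obtain rfl : c₅ = 0 := by linarith
    obtain rfl : c₆ = 0 := by linarith
    module
  · obtain rfl : d₃ = -c₄ := by linarith
    obtain rfl : d₄ = c₃ := by linarith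
    rw [u36₁, u36₂, u36₅, u36₆]
    module
  · obtain rfl : p₃ = 0 := by linarith
    obtain rfl : p₄ = 0 := by linarith
    obtain rfl : p₅ = 0 := by linarith
    obtain rfl : p₆ = 0 := by linarith
    module
  · obtain rfl : q₁ = 0 := by linarith
    obtain rfl : q₂ = 0 := by linarith
    obtain rfl : q₅ = 0 := by linarith
    obtain rfl : q₆ = 0 := by linarith
    module

end SymplecticForm

/-! ### Reconstruction from the reduction by a noncentral line -/

namespace SymplecticForm

variable {𝔤 : Type*} [LieRing 𝔤] [LieAlgebra ℝ 𝔤] {ω : SymplecticForm 𝔤} {j : LieIdeal ℝ 𝔤}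

/-- As `j` is a noncentral line, some `y` acts on it as the identity. Since `j^⊥` is an ideal,
closedness forces both that `y` lies outside `j^⊥` and that `j^⊥` centralizes `j`. -/
theorem IsNormalIsotropic.exists_lie_eq_self (hj : ω.IsNormalIsotropic j)
    (hj1 : Module.finrank ℝ j = 1) (hc : ¬ j ≤ center ℝ 𝔤) :
    ∃ z ∈ j, ∃ y : 𝔤, ⁅y, z⁆ = z ∧ ω.form z y = 1 ∧ (∀ x ∈ ω.orth j, ⁅x, z⁆ = 0) ∧
      ∀ v ∈ j, v = ω.form v y • z := by
  obtain ⟨z, hz, y, hyz⟩ : ∃ z ∈ j, ∃ y : 𝔤, ⁅y, z⁆ ≠ 0 := by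
    by_contra hcon
    push Not at hcon
    exact hc fun z hz => (LieModule.mem_maxTrivSubmodule ℝ 𝔤 𝔤 z).2 fun y => hcon z hz y
  have hz0 : (⟨z, hz⟩ : j) ≠ 0 := by
    intro h
    have : z = 0 := congrArg Subtype.val h
    rw [this, lie_zero] at hyz
    exact hyz rfl
  have hspan : ∀ v ∈ j, ∃ r : ℝ, r • z = v := by
    intro v hv
    obtain ⟨r, hr⟩ := (finrank_eq_one_iff_of_nonzero' (⟨z, hz⟩ : j) hz0).1 hj1 ⟨v, hv⟩
    exact ⟨r, congrArg Subtype.val hr⟩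
  obtain ⟨r, hr⟩ := hspan _ (lie_mem_right ℝ 𝔤 j y z hz)
  have hr0 : r ≠ 0 := by
    rintro rfl
    rw [zero_smul] at hr
    exact hyz hr.symm
  obtain ⟨y', hy'z⟩ : ∃ y' : 𝔤, ⁅y', z⁆ = z :=
    ⟨r⁻¹ • y, by rw [smul_lie, ← hr, smul_smul, inv_mul_cancel₀ hr0, one_smul]⟩
  have horth : ∀ x ∈ ω.orth j, ω.form z x = 0 := fun x hx => by
    rw [ω.form_swap, hx z hz, neg_zero]
  have hs : ω.form z y' ≠ 0 := by
    intro h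
    have hy'j : y' ∈ ω.orth j := by
      intro v hv
      obtain ⟨t, rfl⟩ := hspan v hv
      rw [map_smul, ω.form_swap, h, neg_zero, smul_zero]
    apply hz0
    apply Subtype.ext
    apply ω.eq_zero_of_form_eq_zero
    intro x
    have h1 := ω.closed x y' z
    obtain ⟨t, ht⟩ := hspan _ (lie_mem_left ℝ 𝔤 j z x hz)
    rw [hj.2 x y' hy'j z hz, hy'z, ← ht, map_smul, LinearMap.smul_apply, h] at h1
    simpa using h1
  set s := ω.form z y' with hsdef
  -- Only `z` is rescaled, as `[y', z] = z` is homogeneous in `z`.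
  refine ⟨s⁻¹ • z, j.smul_mem _ hz, y', by rw [lie_smul, hy'z], ?_, ?_, ?_⟩
  · rw [map_smul, LinearMap.smul_apply, ← hsdef, smul_eq_mul, inv_mul_cancel₀ hs]
  · intro x hx
    have h1 := ω.closed x y' z
    obtain ⟨t, ht⟩ := hspan _ (lie_mem_left ℝ 𝔤 j z x hz)
    have h2 : ⁅x, y'⁆ ∈ ω.orth j := by
      rw [← lie_skew]
      exact neg_mem (hj.2 y' x hx)
    rw [h2 z hz, hy'z, horth x hx, ← ht, map_smul, LinearMap.smul_apply, ← hsdef] at h1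
    have ht0 : t = 0 := by simpa [hs] using h1
    rw [lie_smul, ← lie_skew, ← ht, ht0]
    simp
  · intro v hv
    obtain ⟨t, rfl⟩ := hspan v hv
    rw [map_smul, LinearMap.smul_apply, ← hsdef, smul_eq_mul, smul_smul]
    congr 1
    field_simp

/-- The derivation of `𝔧^⊥ / 𝔧` induced by an element of the Lie algebra. -/
theorem IsNormalIsotropic.exists_derivation (hj : ω.IsNormalIsotropic j) (y : 𝔤) :
    ∃ D : ω.Reduction j →ₗ[ℝ] ω.Reduction j,
      (∀ x : ω.orth j, D (LieSubmodule.Quotient.mk x) =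
        LieSubmodule.Quotient.mk (⟨⁅y, (x : 𝔤)⁆, hj.2 y x x.2⟩ : ω.orth j)) ∧
      ∀ u v, D ⁅u, v⁆ = ⁅D u, v⁆ + ⁅u, D v⁆ := by
  let T : ω.orth j →ₗ[ℝ] ω.orth j :=
    ((ad ℝ 𝔤 y) ∘ₗ (ω.orth j).toSubmodule.subtype).codRestrict (ω.orth j).toSubmodule
      fun x => hj.2 y x x.2
  let I := (j.comap (ω.orth j).incl).toSubmodule
  have hT : I ≤ I.comap T := by
    intro x hx
    exact (ω.mem_comap_incl j _).2 (lie_mem_right ℝ 𝔤 j y x ((ω.mem_comap_incl j x).1 hx))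
  have hmk : ∀ x : ω.orth j, I.mapQ I T hT (LieSubmodule.Quotient.mk x) =
        LieSubmodule.Quotient.mk (⟨⁅y, (x : 𝔤)⁆, hj.2 y x x.2⟩ : ω.orth j) := fun x => rfl
  refine ⟨I.mapQ I T hT, hmk, ?_⟩
  intro u v
  induction u using Submodule.Quotient.induction_on with
  | H x =>
    induction v using Submodule.Quotient.induction_on with
    | H x' =>
      change I.mapQ I T hT (LieSubmodule.Quotient.mk (⁅x, x'⁆ : ω.orth j)) =
        LieSubmodule.Quotient.mk ((⁅T x, x'⁆ : ω.orth j) + (⁅x, T x'⁆ : ω.orth j))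
      rw [hmk]
      congr 1
      apply Subtype.ext
      exact leibniz_lie y (x : 𝔤) (x' : 𝔤)

set_option linter.unusedSimpArgs false in
/-- A normal oxidation of `𝔤_(1,0,0,1)` by a line outside the center has a standard frame. -/
theorem IsNormalIsotropic.exists_isNormalFrame [FiniteDimensional ℝ 𝔤]
    (hj : ω.IsNormalIsotropic j)
    (hj1 : Module.finrank ℝ j = 1) (hc : ¬ j ≤ center ℝ 𝔤)
    (h6 : Module.finrank ℝ (ω.Reduction j) = 6) {η : ℝ} (hη : η ≠ 0)
    {E₁ E₂ E₃ E₄ E₅ E₆ : ω.Reduction j} (hE : (ω.reduce j hj.1).IsFrame η E₁ E₂ E₃ E₄ E₅ E₆) :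
    ∃ (a b α β : ℝ) (e₁ e₂ e₃ e₄ e₅ e₆ e₇ e₈ : 𝔤), (a = 0 ∨ a = 1 / 2) ∧ (b = 0 ∨ b = 1 / 2) ∧
      ω.IsNormalFrame a b (-2 * a) (-2 * b) η α β 1 e₁ e₂ e₃ e₄ e₅ e₆ e₇ e₈ := by
  obtain ⟨z, hz, y₀, hy₀z, hzy₀, hzc, hjz⟩ := hj.exists_lie_eq_self hj1 hc
  obtain ⟨D, hDmk, hD⟩ := hj.exists_derivation y₀
  obtain ⟨w, a, b, hD1, hD2, hD3, hD4, hD5, hD6⟩ := hE.exists_derivation hη h6 D hD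
  obtain ⟨w, rfl⟩ := Submodule.Quotient.mk_surjective _ w
  have hzorth : ∀ x : ω.orth j, ω.form z x = 0 := fun x => by
    rw [ω.form_swap, x.2 z hz, neg_zero]
  have hzorth' : ∀ x : ω.orth j, ω.form x z = 0 := fun x => x.2 z hz
  -- Subtracting `w ∈ j^⊥` removes the inner part of the derivation without disturbing `[y,z] = z`
  -- or `ω(z,y) = 1`.
  obtain ⟨y, hy⟩ : ∃ y, y = y₀ - (w : 𝔤) := ⟨_, rfl⟩
  have hyz : ⁅y, z⁆ = z := by rw [hy, sub_lie, hy₀z, hzc w w.2, sub_zero]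
  have hzy : ω.form z y = 1 := by rw [hy, map_sub, hzy₀, hzorth, sub_zero]
  have hjz' : ∀ v ∈ j, v = ω.form v y • z := by
    intro v hv
    have : ω.form v w = 0 := by rw [ω.form_swap, w.2 v hv, neg_zero]
    rw [hy, map_sub, this, sub_zero]
    exact hjz v hv
  have hyn : ∀ x : ω.orth j, ⁅y, (x : 𝔤)⁆ ∈ ω.orth j := fun x => hj.2 y x x.2
  have hymk : ∀ x : ω.orth j, (LieSubmodule.Quotient.mk (⟨⁅y, (x : 𝔤)⁆, hyn x⟩ : ω.orth j) :
      ω.Reduction j) = D (LieSubmodule.Quotient.mk x) -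
        ⁅(LieSubmodule.Quotient.mk w : ω.Reduction j),
          (LieSubmodule.Quotient.mk x : ω.Reduction j)⁆ := by
    intro x
    rw [hDmk]
    change _ = LieSubmodule.Quotient.mk ((⟨⁅y₀, (x : 𝔤)⁆, hj.2 y₀ x x.2⟩ : ω.orth j) - ⁅w, x⁆)
    congr 1
    apply Subtype.ext
    change ⁅y, (x : 𝔤)⁆ = ⁅y₀, (x : 𝔤)⁆ - ⁅(w : 𝔤), (x : 𝔤)⁆
    rw [hy, sub_lie]
  have hker : ∀ x x' : ω.orth j, (LieSubmodule.Quotient.mk x : ω.Reduction j) =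
      LieSubmodule.Quotient.mk x' → (x : 𝔤) = x' + (ω.form (x : 𝔤) y - ω.form (x' : 𝔤) y) • z := by
    intro x x' h
    have h1 : x - x' ∈ (j.comap (ω.orth j).incl).toSubmodule :=
      (Submodule.Quotient.eq _).1 h
    have h2 := hjz' _ ((ω.mem_comap_incl j _).1 h1)
    have h3 : ((x - x' : ω.orth j) : 𝔤) = (x : 𝔤) - x' := rfl
    rw [h3, map_sub, LinearMap.sub_apply] at h2
    rw [← h2]
    abel
  -- Lifts are ambiguous by multiples of `z`; since `ω(z,y) = 1`, requiring orthogonality to `y`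
  -- fixes that multiple.
  have hlift : ∀ E : ω.Reduction j, ∃ x : ω.orth j, LieSubmodule.Quotient.mk x = E ∧
      ω.form (x : 𝔤) y = 0 := by
    intro E
    obtain ⟨x, rfl⟩ := Submodule.Quotient.mk_surjective _ E
    refine ⟨x - ω.form (x : 𝔤) y • ⟨z, hj.1 z hz⟩, ?_, ?_⟩
    · refine (Submodule.Quotient.eq _).2 ((ω.mem_comap_incl j _).2 ?_)
      change ((x : 𝔤) - ω.form (x : 𝔤) y • z) - x ∈ j
      have : ((x : 𝔤) - ω.form (x : 𝔤) y • z) - x = -(ω.form (x : 𝔤) y • z) := by abel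
      rw [this]
      exact neg_mem (j.smul_mem _ hz)
    · change ω.form ((x : 𝔤) - ω.form (x : 𝔤) y • z) y = 0
      rw [map_sub, map_smul, LinearMap.sub_apply, LinearMap.smul_apply, hzy]
      simp
  obtain ⟨x₁, rfl, g1⟩ := hlift E₁
  obtain ⟨x₂, rfl, g2⟩ := hlift E₂
  obtain ⟨x₃, rfl, g3⟩ := hlift E₃
  obtain ⟨x₄, rfl, g4⟩ := hlift E₄
  obtain ⟨x₅, rfl, g5⟩ := hlift E₅
  obtain ⟨x₆, rfl, g6⟩ := hlift E₆
  have hact : ∀ (x : ω.orth j) (c : ℝ), ω.form (x : 𝔤) y = 0 →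
      D (LieSubmodule.Quotient.mk x) -
        ⁅(LieSubmodule.Quotient.mk w : ω.Reduction j),
          (LieSubmodule.Quotient.mk x : ω.Reduction j)⁆ = c • LieSubmodule.Quotient.mk x → ∃ μ : ℝ, ⁅y, (x : 𝔤)⁆ = c • (x : 𝔤) + μ • z := by
    intro x c hx h
    rw [← hymk] at h
    exact ⟨_, hker _ (c • x) h⟩
  obtain ⟨μ₁, m1⟩ := hact x₁ a g1 hD1
  obtain ⟨μ₂, m2⟩ := hact x₂ a g2 hD2
  obtain ⟨μ₃, m3⟩ := hact x₃ b g3 hD3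
  obtain ⟨μ₄, m4⟩ := hact x₄ b g4 hD4
  obtain ⟨μ₅, m5⟩ := hact x₅ 0 g5 (by rw [zero_smul]; exact hD5)
  obtain ⟨μ₆, m6⟩ := hact x₆ 0 g6 (by rw [zero_smul]; exact hD6)
  -- Pairing with `y` reads off the `z`-component of `[u,v]`, and closedness expresses it through
  -- the action of `y`. For `x₁, x₂` this gives `-2a`, for `x₃, x₄` it gives `-2b`.
  have hlie : ∀ u v t : ω.orth j, ω.form (t : 𝔤) y = 0 →
      ⁅(LieSubmodule.Quotient.mk u : ω.Reduction j), (LieSubmodule.Quotient.mk v : ω.Reduction j)⁆ =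
        (LieSubmodule.Quotient.mk t : ω.Reduction j) →
      ⁅(u : 𝔤), (v : 𝔤)⁆ = t + (ω.form ⁅y, (v : 𝔤)⁆ u - ω.form ⁅y, (u : 𝔤)⁆ v) • z := by
    intro u v t ht h
    have h1 := hker (⁅u, v⁆ : ω.orth j) t h
    have h2 := ω.closed u v y
    change ⁅(u : 𝔤), (v : 𝔤)⁆ = t + (ω.form ⁅(u : 𝔤), (v : 𝔤)⁆ y - _) • z at h1
    rw [h1, ht]
    congr 2
    rw [← lie_skew (v : 𝔤) y, map_neg, LinearMap.neg_apply] at h2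
    linarith
  have f12 : ω.form (x₁ : 𝔤) x₂ = 1 := hE.form12
  have f13 : ω.form (x₁ : 𝔤) x₃ = 0 := hE.form13
  have f14 : ω.form (x₁ : 𝔤) x₄ = 0 := hE.form14
  have f15 : ω.form (x₁ : 𝔤) x₅ = 0 := hE.form15
  have f16 : ω.form (x₁ : 𝔤) x₆ = 0 := hE.form16
  have f23 : ω.form (x₂ : 𝔤) x₃ = 0 := hE.form23
  have f24 : ω.form (x₂ : 𝔤) x₄ = 0 := hE.form24
  have f25 : ω.form (x₂ : 𝔤) x₅ = 0 := hE.form25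
  have f26 : ω.form (x₂ : 𝔤) x₆ = 0 := hE.form26
  have f34 : ω.form (x₃ : 𝔤) x₄ = 1 := hE.form34
  have f35 : ω.form (x₃ : 𝔤) x₅ = 0 := hE.form35
  have f36 : ω.form (x₃ : 𝔤) x₆ = 0 := hE.form36
  have f45 : ω.form (x₄ : 𝔤) x₅ = 0 := hE.form45
  have f46 : ω.form (x₄ : 𝔤) x₆ = 0 := hE.form46
  have f56 : ω.form (x₅ : 𝔤) x₆ = η := hE.form56
  have s : ∀ u v : ω.orth j, ω.form (u : 𝔤) v = -ω.form (v : 𝔤) u := fun u v => ω.form_swap u v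
  have hF : ∀ (u v : ω.orth j) (c μ : ℝ), ω.form (c • (u : 𝔤) + μ • z) v = c * ω.form (u : 𝔤) v := by
    intro u v c μ
    rw [map_add, map_smul, map_smul, LinearMap.add_apply, LinearMap.smul_apply,
      LinearMap.smul_apply, hzorth, smul_zero, add_zero, smul_eq_mul]
  have hzero : ω.form ((0 : ω.orth j) : 𝔤) y = 0 := by
    rw [ZeroMemClass.coe_zero, map_zero, LinearMap.zero_apply]
  have hneg : ∀ u : ω.orth j, ω.form (u : 𝔤) y = 0 → ω.form ((-u : ω.orth j) : 𝔤) y = 0 := by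
    intro u hu
    rw [NegMemClass.coe_neg, map_neg, LinearMap.neg_apply, hu, neg_zero]
  have hlie' : ∀ (u v t : ω.orth j) (r : 𝔤), ω.form (t : 𝔤) y = 0 →
      ⁅(LieSubmodule.Quotient.mk u : ω.Reduction j), (LieSubmodule.Quotient.mk v : ω.Reduction j)⁆ =
        (LieSubmodule.Quotient.mk t : ω.Reduction j) → ∀ c : ℝ,
      ω.form ⁅y, (v : 𝔤)⁆ u - ω.form ⁅y, (u : 𝔤)⁆ v = c → (t : 𝔤) + c • z = r →
      ⁅(u : 𝔤), (v : 𝔤)⁆ = r := by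
    intro u v t r ht h c h1 h2
    rw [hlie u v t ht h, h1, h2]
  have b12 : ⁅(x₁ : 𝔤), (x₂ : 𝔤)⁆ = (-2 * a) • z :=
    hlie' x₁ x₂ 0 _ hzero hE.lie12 (-2 * a) (by
      rw [m1, m2]
      simp only [hF, s x₂ x₁, f12]
      ring) (by simp)
  have b13 : ⁅(x₁ : 𝔤), (x₃ : 𝔤)⁆ = 0 :=
    hlie' x₁ x₃ 0 _ hzero hE.lie13 (0) (by
      rw [m1, m3]
      simp only [hF, s x₃ x₁, f13]
      ring) (by simp)
  have b14 : ⁅(x₁ : 𝔤), (x₄ : 𝔤)⁆ = 0 :=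
    hlie' x₁ x₄ 0 _ hzero hE.lie14 (0) (by
      rw [m1, m4]
      simp only [hF, s x₄ x₁, f14]
      ring) (by simp)
  have b15 : ⁅(x₁ : 𝔤), (x₅ : 𝔤)⁆ = (x₂ : 𝔤) :=
    hlie' x₁ x₅ x₂ _ g2 hE.lie15 (0) (by
      rw [m1, m5]
      simp only [hF, s x₅ x₁, f15]
      ring) (by simp)
  have b16 : ⁅(x₁ : 𝔤), (x₆ : 𝔤)⁆ = 0 :=
    hlie' x₁ x₆ 0 _ hzero hE.lie16 (0) (by
      rw [m1, m6]
      simp only [hF, s x₆ x₁, f16]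
      ring) (by simp)
  have b23 : ⁅(x₂ : 𝔤), (x₃ : 𝔤)⁆ = 0 :=
    hlie' x₂ x₃ 0 _ hzero hE.lie23 (0) (by
      rw [m2, m3]
      simp only [hF, s x₃ x₂, f23]
      ring) (by simp)
  have b24 : ⁅(x₂ : 𝔤), (x₄ : 𝔤)⁆ = 0 :=
    hlie' x₂ x₄ 0 _ hzero hE.lie24 (0) (by
      rw [m2, m4]
      simp only [hF, s x₄ x₂, f24]
      ring) (by simp)
  have b25 : ⁅(x₂ : 𝔤), (x₅ : 𝔤)⁆ = -(x₁ : 𝔤) :=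
    hlie' x₂ x₅ (-x₁) _ (hneg _ g1) hE.lie25 (0) (by
      rw [m2, m5]
      simp only [hF, s x₅ x₂, f25]
      ring) (by simp)
  have b26 : ⁅(x₂ : 𝔤), (x₆ : 𝔤)⁆ = 0 :=
    hlie' x₂ x₆ 0 _ hzero hE.lie26 (0) (by
      rw [m2, m6]
      simp only [hF, s x₆ x₂, f26]
      ring) (by simp)
  have b34 : ⁅(x₃ : 𝔤), (x₄ : 𝔤)⁆ = (-2 * b) • z :=
    hlie' x₃ x₄ 0 _ hzero hE.lie34 (-2 * b) (by
      rw [m3, m4]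
      simp only [hF, s x₄ x₃, f34]
      ring) (by simp)
  have b35 : ⁅(x₃ : 𝔤), (x₅ : 𝔤)⁆ = 0 :=
    hlie' x₃ x₅ 0 _ hzero hE.lie35 (0) (by
      rw [m3, m5]
      simp only [hF, s x₅ x₃, f35]
      ring) (by simp)
  have b36 : ⁅(x₃ : 𝔤), (x₆ : 𝔤)⁆ = (x₄ : 𝔤) :=
    hlie' x₃ x₆ x₄ _ g4 hE.lie36 (0) (by
      rw [m3, m6]
      simp only [hF, s x₆ x₃, f36]
      ring) (by simp)
  have b45 : ⁅(x₄ : 𝔤), (x₅ : 𝔤)⁆ = 0 :=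
    hlie' x₄ x₅ 0 _ hzero hE.lie45 (0) (by
      rw [m4, m5]
      simp only [hF, s x₅ x₄, f45]
      ring) (by simp)
  have b46 : ⁅(x₄ : 𝔤), (x₆ : 𝔤)⁆ = -(x₃ : 𝔤) :=
    hlie' x₄ x₆ (-x₃) _ (hneg _ g3) hE.lie46 (0) (by
      rw [m4, m6]
      simp only [hF, s x₆ x₄, f46]
      ring) (by simp)
  have b56 : ⁅(x₅ : 𝔤), (x₆ : 𝔤)⁆ = 0 :=
    hlie' x₅ x₆ 0 _ hzero hE.lie56 (0) (by
      rw [m5, m6]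
      simp only [hF, s x₆ x₅, f56]
      ring) (by simp)
  have hz0 : z ≠ 0 := by
    rintro rfl
    simp at hzy
  have jac : ∀ u v : ω.orth j, ⁅y, ⁅(u : 𝔤), (v : 𝔤)⁆⁆ = ⁅⁅y, (u : 𝔤)⁆, (v : 𝔤)⁆ +
      ⁅(u : 𝔤), ⁅y, (v : 𝔤)⁆⁆ := fun u v => leibniz_lie y (u : 𝔤) (v : 𝔤)
  have hzl : ∀ x : ω.orth j, ⁅z, (x : 𝔤)⁆ = 0 := fun x => by
    rw [← lie_skew, hzc x x.2, neg_zero]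
  have hzr : ∀ x : ω.orth j, ⁅(x : 𝔤), z⁆ = 0 := fun x => hzc x x.2
  -- The first two identities give `a(2a-1) = 0` and `b(2b-1) = 0`; the other four make `μ₁, …, μ₄`
  -- vanish.
  have j12 := jac x₁ x₂
  have j34 := jac x₃ x₄
  have j15 := jac x₁ x₅
  have j25 := jac x₂ x₅
  have j36 := jac x₃ x₆
  have j46 := jac x₄ x₆
  simp only [b12, b34, b15, b25, b36, b46, m1, m2, m3, m4, m5, m6, lie_smul, smul_lie, add_lie,
    lie_add, lie_neg, hzl, hzr, hyz, smul_zero, add_zero, zero_smul, zero_add]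
    at j12 j34 j15 j25 j36 j46
  have n1 : ⁅y, (x₁ : 𝔤)⁆ = a • (x₁ : 𝔤) := by
    rw [m1, ← neg_inj, j25, smul_neg]
  have n2 : ⁅y, (x₂ : 𝔤)⁆ = a • (x₂ : 𝔤) := by rw [m2, j15]
  have n3 : ⁅y, (x₃ : 𝔤)⁆ = b • (x₃ : 𝔤) := by
    rw [m3, ← neg_inj, j46, smul_neg]
  have n4 : ⁅y, (x₄ : 𝔤)⁆ = b • (x₄ : 𝔤) := by rw [m4, j36]
  have hquad : ∀ c : ℝ, (-2 * c) • z = c • (-2 * c) • z + c • (-2 * c) • z →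
      c = 0 ∨ c = 1 / 2 := by
    intro c h
    have h1 : (c * (2 * c - 1)) • z = 0 := by
      rw [← sub_eq_zero] at h
      have h2 : (c * (2 * c - 1)) • z =
          (1 / 2 : ℝ) • ((-2 * c) • z - (c • (-2 * c) • z + c • (-2 * c) • z)) := by module
      rw [h2, h, smul_zero]
    rcases mul_eq_zero.1 ((smul_eq_zero.1 h1).resolve_right hz0) with h | h
    · exact Or.inl h
    · exact Or.inr (by linarith)
  have n5 : ⁅y, (x₅ : 𝔤)⁆ = μ₅ • z := by rw [m5, zero_smul, zero_add]
  have n6 : ⁅y, (x₆ : 𝔤)⁆ = μ₆ • z := by rw [m6, zero_smul, zero_add]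
  -- Shifting `x₅` and `x₆` by multiples of `z` makes them commute with `y`, at the price of nonzero
  -- pairings `-μ₅` and `-μ₆` with it.
  refine ⟨a, b, -μ₅, -μ₆, x₁, x₂, x₃, x₄, x₅ - μ₅ • z, x₆ - μ₆ • z, z, y, hquad a j12,
    hquad b j34, ?_⟩
  constructor
  all_goals
    simp only [lie_sub, sub_lie, lie_smul, smul_lie, lie_self, b12, b13, b14, b15, b16, b23, b24,
      b25, b26, b34, b35, b36, b45, b46, b56, n1, n2, n3, n4, n5, n6, hzl, hzr, hyz, map_sub,
      map_smul, LinearMap.sub_apply, LinearMap.smul_apply, smul_eq_mul, f12, f13, f14, f15, f16,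
      f23, f24, f25, f26, f34, f35, f36, f45, f46, f56, hzorth, hzorth', hzy, g1, g2, g3, g4, g5,
      g6, ω.alt z, smul_zero, sub_zero, mul_zero, mul_one, sub_self, zero_sub]

end SymplecticForm

/-! ### The four families -/

theorem mainTheorem7 {𝔤 : Type*} [LieRing 𝔤] [LieAlgebra ℝ 𝔤] [FiniteDimensional ℝ 𝔤]
    (hdim : Module.finrank ℝ 𝔤 = 8) (ω : SymplecticForm 𝔤)
    (hω : ¬ ω.IsCompletelyReducible)
    (hj : ∃ j : LieIdeal ℝ 𝔤, j ≠ ⊥ ∧ ω.IsNormalIsotropic j ∧ ¬ j ≤ LieAlgebra.center ℝ 𝔤) :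
    (∃ (η α β : ℝ) (hη : 0 < η), Symplectomorphic ω (NormalData.ω81 η α β hη)) ∨
    (∃ (t η α β : ℝ) (ht : t ≠ 0) (hη : 0 < η),
      Symplectomorphic ω (NormalData.ω82 t η α β ht hη)) ∨
    (∃ (t η α β : ℝ) (ht : t ≠ 0) (hη : 0 < η),
      Symplectomorphic ω (NormalData.ω83 t η α β ht hη)) ∨
    (∃ (t η α β : ℝ) (ht : t ≠ 0) (hη : 0 < η),
      Symplectomorphic ω (NormalData.ω84 t η α β ht hη)) := by
  obtain ⟨j, hj0, hj, hc⟩ := hj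
  have hdimj := ω.finrank_reduction j hj.1
  have hjpos : Module.finrank ℝ j ≠ 0 := fun h =>
    hj0 ((LieSubmodule.toSubmodule_eq_bot j).1 (Submodule.finrank_eq_zero.1 h))
  obtain ⟨h6, hirr, hnt⟩ := SymplecticForm.irreducible_of_not_isCompletelyReducible
    (Module.finrank ℝ (ω.Reduction j)) (ω.reduce j hj.1) rfl (by omega)
    fun h => hω (SymplecticForm.IsCompletelyReducible.step ω j hj.1 h)
  obtain ⟨η, E₁, E₂, E₃, E₄, E₅, E₆, hη, hE⟩ := hirr.exists_isFrame h6.le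
  obtain ⟨a, b, α, β, e₁, e₂, e₃, e₄, e₅, e₆, e₇, e₈, ha, hb, h⟩ :=
    hj.exists_isNormalFrame (by omega) hc h6 hη.ne' hE
  -- The frame has `ω(e₇,e₈) = 1`, matching `-1/t` for `t = -1`; a weight `1/2` gives the bracket
  -- coefficient `-2 · 1/2 = -1 = t`.
  rcases ha with rfl | rfl <;> rcases hb with rfl | rfl
  · refine Or.inl ⟨η, α, β, hη, ?_⟩
    refine SymplecticForm.IsNormalFrame.symplectomorphic NormalData.g81
      (e₁ := e₁) (e₂ := e₂) (e₃ := e₃) (e₄ := e₄) (e₅ := e₅) (e₆ := e₆) (e₇ := e₇) (e₈ := e₈)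
      ?_ hdim _ _ _ _
    simpa [NormalData.g81] using h
  · refine Or.inr (Or.inr (Or.inr ⟨-1, η, α, β, by norm_num, hη, ?_⟩))
    refine SymplecticForm.IsNormalFrame.symplectomorphic (NormalData.g84 (-1))
      (e₁ := e₁) (e₂ := e₂) (e₃ := e₃) (e₄ := e₄) (e₅ := e₅) (e₆ := e₆) (e₇ := e₇) (e₈ := e₈)
      ?_ hdim _ _ _ _
    simpa [NormalData.g84] using h
  · refine Or.inr (Or.inr (Or.inl ⟨-1, η, α, β, by norm_num, hη, ?_⟩))
    refine SymplecticForm.IsNormalFrame.symplectomorphic (NormalData.g83 (-1))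
      (e₁ := e₁) (e₂ := e₂) (e₃ := e₃) (e₄ := e₄) (e₅ := e₅) (e₆ := e₆) (e₇ := e₇) (e₈ := e₈)
      ?_ hdim _ _ _ _
    simpa [NormalData.g83] using h
  · refine Or.inr (Or.inl ⟨-1, η, α, β, by norm_num, hη, ?_⟩)
    refine SymplecticForm.IsNormalFrame.symplectomorphic (NormalData.g82 (-1))
      (e₁ := e₁) (e₂ := e₂) (e₃ := e₃) (e₄ := e₄) (e₅ := e₅) (e₆ := e₆) (e₇ := e₇) (e₈ := e₈)
      ?_ hdim _ _ _ _
    simpa [NormalData.g82] using h
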